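/- For an integer $k\ge 0$ and real $x$ let $f_k(x)=e^{x}-\sum_{i=0}^{k-1}x^i/i!$. For $k\ge 3$ and $\mu>0$ let $h_k(\mu)=e^{\mu}\mu/f_{k-1}(\mu)$, let $c_k=\inf\{h_k(\mu):\mu>0\}$, let $\mu_{k,c_k}$ be the unique $\mu>0$ with $h_k(\mu)=c_k$, and let $$c_k'=\frac{\mu_{k,c_k}\,f_{k-1}(\mu_{k,c_k})}{f_k(\mu_{k,c_k})}.$$ The $k$-core of a finite simple graph is its maximal (possibly empty) subgraph of minimum degree at least $k$. For a simple graph $G$ with vertex set $[n]$ and at least one edge, choose an edge $e$ of $G$ uniformly at random and let $W(G)=n-|V(K)|$, where $K$ is the $k$-core of $G-e$. Let $G(k,n,m)$ be chosen uniformly at random among the simple graphs with vertex set $[n]$, exactly $m$ edges and minimum degree at least $k$. Lemma. Let $k\ge 3$ be a fixed integer, let $\varepsilon>0$ be a fixed real number, and let $m=m(n)$ be such that $c=2m/n$ satisfies $k+\varepsilon\le c\le c_k'-\varepsilon$ for all sufficiently large $n$. Then there exists a function $h(n)\to\infty$ such that $\mathbb P\big(W(G(k,n,m))\ge h(n)\big)=\Omega(1)$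 as $n\to\infty$; that is, there is a constant $\delta>0$ such that this probability, over the random graph and the random edge, is at least $\delta$ for all sufficiently large $n$. -/

import Mathlib

open Filter Topology

noncomputable section

namespace CoreRobustness

/-- The tail of the exponential series, `f_k(x) = e^x - ∑_{i<k} x^i / i!`. -/
def expTail (k : ℕ) (x : ℝ) : ℝ :=
  Real.exp x - ∑ i ∈ Finset.range k, x ^ i / (i.factorial : ℝ)

/-- `h_k(μ) = e^μ μ / f_{k-1}(μ)`, used for `k ≥ 3` and `μ > 0`. -/
def hFun (k : ℕ) (μ : ℝ) : ℝ :=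
  Real.exp μ * μ / expTail (k - 1) μ

/-- `c_k = inf {h_k(μ) : μ > 0}`. -/
def cConst (k : ℕ) : ℝ :=
  sInf (hFun k '' Set.Ioi 0)

/-- `μ_{k,c_k}`, the positive root of `h_k(μ) = c_k`. For `k ≥ 3` it exists and is unique,
see `existsUnique_muConst` and `muConst_spec` below. -/
def muConst (k : ℕ) : ℝ :=
  sSup {μ : ℝ | 0 < μ ∧ hFun k μ = cConst k}

/-- `c_k' = μ f_{k-1}(μ) / f_k(μ)` with `μ = μ_{k,c_k}`. -/
def cPrime (k : ℕ) : ℝ :=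
  muConst k * expTail (k - 1) (muConst k) / expTail k (muConst k)

/-! Well-definedness of `μ_{k,c_k}`. -/

theorem hasDerivAt_expTail (k : ℕ) (x : ℝ) :
    HasDerivAt (expTail (k + 1)) (expTail k x) x := by
  have h : ∀ k : ℕ, HasDerivAt (fun x : ℝ => ∑ i ∈ Finset.range (k + 1), x ^ i / (i.factorial : ℝ))
      (∑ i ∈ Finset.range k, x ^ i / (i.factorial : ℝ)) x := by
    intro k
    induction k with
    | zero => simpa using hasDerivAt_const x (1 : ℝ)
    | succ k ih =>
      rw [Finset.sum_range_succ]
      have h2 := (hasDerivAt_pow (k + 1) x).div_const ((k + 1).factorial : ℝ)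
      have h3 : ((k + 1 : ℕ) : ℝ) * x ^ (k + 1 - 1) / ((k + 1).factorial : ℝ)
          = x ^ k / (k.factorial : ℝ) := by
        have : (k.factorial : ℝ) ≠ 0 := by positivity
        have : ((k : ℝ) + 1) ≠ 0 := by positivity
        rw [Nat.factorial_succ]
        push_cast
        field_simp
      rw [h3] at h2
      have h4 := ih.add h2
      refine h4.congr_of_eventuallyEq (Eventually.of_forall fun y => ?_)
      exact Finset.sum_range_succ (fun i : ℕ => y ^ i / (i.factorial : ℝ)) (k + 1)
  exact (Real.hasDerivAt_exp x).sub (h k)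

theorem expTail_eq_add (k : ℕ) (x : ℝ) :
    expTail k x = expTail (k + 1) x + x ^ k / (k.factorial : ℝ) := by
  simp only [expTail, Finset.sum_range_succ]
  ring

theorem expTail_zero_right (k : ℕ) : expTail (k + 1) 0 = 0 := by
  simp [expTail, Finset.sum_range_succ']

theorem expTail_pos (k : ℕ) : ∀ x : ℝ, 0 < x → 0 < expTail k x := by
  induction k with
  | zero => intro x _; simpa [expTail] using Real.exp_pos x
  | succ k ih =>
    intro x hx
    have hmono : StrictMonoOn (expTail (k + 1)) (Set.Ici 0) := by
      refine strictMonoOn_of_deriv_pos (convex_Ici 0)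
        (fun y _ => (hasDerivAt_expTail k y).continuousAt.continuousWithinAt) ?_
      intro y hy
      rw [interior_Ici] at hy
      rw [(hasDerivAt_expTail k y).deriv]
      exact ih y hy
    have := hmono Set.self_mem_Ici (Set.mem_Ici.2 hx.le) hx
    rwa [expTail_zero_right] at this

/-- `F(x) = e^{-x} f_{j+2}(x)`. -/
theorem hasDerivAt_scaled (j : ℕ) (x : ℝ) :
    HasDerivAt (fun x => Real.exp (-x) * expTail (j + 2) x)
      (Real.exp (-x) * (x ^ (j + 1) / ((j + 1).factorial : ℝ))) x := by
  have h1 : HasDerivAt (fun x : ℝ => Real.exp (-x)) (Real.exp (-x) * (-1)) x :=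
    (hasDerivAt_id x).neg.exp
  have h2 := h1.mul (hasDerivAt_expTail (j + 1) x)
  refine h2.congr_deriv ?_
  rw [expTail_eq_add (j + 1)]
  ring

theorem hasDerivAt_slope (j : ℕ) (x : ℝ) :
    HasDerivAt (fun x => Real.exp (-x) * (x ^ (j + 2) / ((j + 1).factorial : ℝ))
        - Real.exp (-x) * expTail (j + 2) x)
      (Real.exp (-x) * (x ^ (j + 1) / ((j + 1).factorial : ℝ)) * ((j + 1 : ℝ) - x)) x := by
  have h1 : HasDerivAt (fun x : ℝ => Real.exp (-x)) (Real.exp (-x) * (-1)) x :=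
    (hasDerivAt_id x).neg.exp
  have h2 := (h1.mul ((hasDerivAt_pow (j + 2) x).div_const ((j + 1).factorial : ℝ))).sub
    (hasDerivAt_scaled j x)
  refine h2.congr_deriv ?_
  have : j + 2 - 1 = j + 1 := rfl
  rw [this]
  push_cast
  ring

theorem exists_turning (j : ℕ) : ∃ a : ℝ, 0 < a ∧
    (∀ x, 0 < x → x < a → 0 < Real.exp (-x) * (x ^ (j + 2) / ((j + 1).factorial : ℝ))
        - Real.exp (-x) * expTail (j + 2) x) ∧
    (∀ x, a < x → Real.exp (-x) * (x ^ (j + 2) / ((j + 1).factorial : ℝ))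
        - Real.exp (-x) * expTail (j + 2) x < 0) := by
  set G : ℝ → ℝ := fun x => Real.exp (-x) * (x ^ (j + 2) / ((j + 1).factorial : ℝ))
        - Real.exp (-x) * expTail (j + 2) x with hG
  have hd : ∀ x, HasDerivAt G _ x := hasDerivAt_slope j
  have hcont : Continuous G := continuous_iff_continuousAt.2 fun x => (hd x).continuousAt
  have hj : (0 : ℝ) < j + 1 := by positivity
  have hG0 : G 0 = 0 := by simp [hG, expTail_zero_right (j + 1)]
  have hup : StrictMonoOn G (Set.Icc 0 (j + 1 : ℝ)) := by
    refine strictMonoOn_of_deriv_pos (convex_Icc _ _) hcont.continuousOn ?_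
    intro y hy
    rw [interior_Icc] at hy
    rw [(hd y).deriv]
    have h1 := hy.1
    have h2 : 0 < (j + 1 : ℝ) - y := sub_pos.2 hy.2
    positivity
  have hdown : StrictAntiOn G (Set.Ici (j + 1 : ℝ)) := by
    refine strictAntiOn_of_deriv_neg (convex_Ici _) hcont.continuousOn ?_
    intro y hy
    rw [interior_Ici] at hy
    rw [(hd y).deriv]
    have h1 : 0 < y := hj.trans hy
    have h2 : (j + 1 : ℝ) - y < 0 := sub_neg.2 hy
    exact mul_neg_of_pos_of_neg (by positivity) h2
  have hterm : ∀ (i : ℕ) (c : ℝ), Tendsto (fun x : ℝ => Real.exp (-x) * (x ^ i / c)) atTop (𝓝 0) := by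
    intro i c
    have := (Real.tendsto_pow_mul_exp_neg_atTop_nhds_zero i).div_const c
    rw [zero_div] at this
    refine this.congr fun x => ?_
    ring
  have hlim : Tendsto G atTop (𝓝 (-1)) := by
    have h1 : Tendsto (fun x : ℝ => Real.exp (-x) * (x ^ (j + 2) / ((j + 1).factorial : ℝ))
        - (1 - ∑ i ∈ Finset.range (j + 2), Real.exp (-x) * (x ^ i / (i.factorial : ℝ)))) atTop
        (𝓝 (0 - (1 - ∑ i ∈ Finset.range (j + 2), (0 : ℝ)))) :=
      (hterm _ _).sub (tendsto_const_nhds.sub (tendsto_finsetSum _ fun i _ => hterm i _))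
    have h2 : (0 - (1 - ∑ i ∈ Finset.range (j + 2), (0 : ℝ))) = -1 := by simp
    rw [h2] at h1
    refine h1.congr fun x => ?_
    simp only [hG, expTail, mul_sub, Finset.mul_sum]
    rw [← Real.exp_add]
    simp
  obtain ⟨b, hb1, hb2⟩ := ((hlim.eventually_lt_const (show (-1 : ℝ) < 0 by norm_num)).and
    (eventually_gt_atTop (j + 1 : ℝ))).exists
  have hpos : 0 < G (j + 1) := by
    have := hup (Set.left_mem_Icc.2 hj.le) (Set.right_mem_Icc.2 hj.le) hj
    rwa [hG0] at this
  obtain ⟨a, ha, ha0⟩ := intermediate_value_Icc' hb2.le hcont.continuousOn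
    (show (0 : ℝ) ∈ Set.Icc (G b) (G (j + 1)) from ⟨hb1.le, hpos.le⟩)
  refine ⟨a, hj.trans_le ha.1, fun x hx hxa => ?_, fun x hx => ?_⟩
  · rcases le_total x (j + 1 : ℝ) with h | h
    · have := hup (Set.left_mem_Icc.2 hj.le) ⟨hx.le, h⟩ hx
      rwa [hG0] at this
    · have := hdown h ha.1 hxa
      rwa [ha0] at this
  · have := hdown ha.1 (ha.1.trans hx.le) hx
    rwa [ha0] at this

theorem exists_strict_min (k : ℕ) (hk : 3 ≤ k) :
    ∃ a : ℝ, 0 < a ∧ ∀ x : ℝ, 0 < x → x ≠ a → hFun k a < hFun k x := by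
  obtain ⟨j, rfl⟩ : ∃ j, k = j + 3 := ⟨k - 3, by omega⟩
  obtain ⟨a, ha, hlo, hhi⟩ := exists_turning j
  set r : ℝ → ℝ := fun x => Real.exp (-x) * expTail (j + 2) x / x with hr
  have hd : ∀ x, 0 < x → HasDerivAt r ((Real.exp (-x) * (x ^ (j + 2) / ((j + 1).factorial : ℝ))
        - Real.exp (-x) * expTail (j + 2) x) / x ^ 2) x := by
    intro x hx
    have := (hasDerivAt_scaled j x).div (hasDerivAt_id x) hx.ne'
    refine this.congr_deriv ?_
    have hx' := hx.ne'
    simp only [id_eq, mul_one]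
    field_simp
    ring
  have hrh : ∀ x, 0 < x → hFun (j + 3) x = (r x)⁻¹ := by
    intro x hx
    have h1 := (expTail_pos (j + 2) x hx).ne'
    simp only [hFun, hr, Real.exp_neg]
    have h2 : j + 3 - 1 = j + 2 := rfl
    rw [h2]
    field_simp
  have hrpos : ∀ x, 0 < x → 0 < r x := fun x hx =>
    div_pos (mul_pos (Real.exp_pos _) (expTail_pos _ x hx)) hx
  have hup : StrictMonoOn r (Set.Ioc 0 a) := by
    refine strictMonoOn_of_deriv_pos (convex_Ioc _ _)
      (fun y hy => (hd y hy.1).continuousAt.continuousWithinAt) ?_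
    intro y hy
    rw [interior_Ioc] at hy
    rw [(hd y hy.1).deriv]
    exact div_pos (hlo y hy.1 hy.2) (pow_pos hy.1 2)
  have hdown : StrictAntiOn r (Set.Ici a) := by
    refine strictAntiOn_of_deriv_neg (convex_Ici _)
      (fun y hy => (hd y (ha.trans_le hy)).continuousAt.continuousWithinAt) ?_
    intro y hy
    rw [interior_Ici] at hy
    have hy0 : 0 < y := ha.trans hy
    rw [(hd y hy0).deriv]
    exact div_neg_of_neg_of_pos (hhi y hy) (pow_pos hy0 2)
  refine ⟨a, ha, fun x hx hxa => ?_⟩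
  rw [hrh a ha, hrh x hx]
  refine inv_strictAnti₀ (hrpos x hx) ?_
  rcases lt_or_gt_of_ne hxa with h | h
  · exact hup ⟨hx, h.le⟩ ⟨ha, le_rfl⟩ h
  · exact hdown Set.self_mem_Ici h.le h

/-- For `k ≥ 3` the infimum `c_k` is attained at exactly one positive point. -/
theorem existsUnique_muConst (k : ℕ) (hk : 3 ≤ k) :
    ∃! μ : ℝ, 0 < μ ∧ hFun k μ = cConst k := by
  obtain ⟨a, ha, hmin⟩ := exists_strict_min k hk
  have hleast : IsLeast (hFun k '' Set.Ioi 0) (hFun k a) := by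
    refine ⟨⟨a, ha, rfl⟩, ?_⟩
    rintro _ ⟨x, hx, rfl⟩
    by_cases h : x = a
    · rw [h]
    · exact (hmin x hx h).le
  have hc : cConst k = hFun k a := hleast.csInf_eq
  refine ⟨a, ⟨ha, hc.symm⟩, ?_⟩
  rintro x ⟨hx, hxc⟩
  by_contra h
  exact absurd (hxc.trans hc) (hmin x hx h).ne'

theorem muConst_spec (k : ℕ) (hk : 3 ≤ k) :
    0 < muConst k ∧ hFun k (muConst k) = cConst k := by
  obtain ⟨a, ha, huniq⟩ := existsUnique_muConst k hk
  have hset : {μ : ℝ | 0 < μ ∧ hFun k μ = cConst k} = {a} :=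
    Set.eq_singleton_iff_unique_mem.2 ⟨ha, huniq⟩
  have : muConst k = a := by rw [muConst, hset, csSup_singleton]
  rw [this]
  exact ha

/-! The `k`-core and the number of vertices lost. -/

/-- The subgraph `H` has minimum degree at least `k` (this holds for the empty subgraph). -/
def HasMinDegree {V : Type*} {G : SimpleGraph V} (k : ℕ) (H : G.Subgraph) : Prop :=
  ∀ v ∈ H.verts, k ≤ (H.neighborSet v).ncard

/-- The `k`-core of `G`: the maximal subgraph of minimum degree at least `k`, possibly empty.
It is the join of all subgraphs of minimum degree at least `k`. -/
def kCore {V : Type*} (k : ℕ) (G : SimpleGraph V) : G.Subgraph :=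
  sSup {H : G.Subgraph | HasMinDegree k H}

/-- On a finite vertex set `kCore k G` is indeed the largest subgraph of minimum degree
at least `k`. -/
theorem isGreatest_kCore {V : Type*} [Finite V] (k : ℕ) (G : SimpleGraph V) :
    IsGreatest {H : G.Subgraph | HasMinDegree k H} (kCore k G) := by
  refine ⟨?_, fun H hH => le_sSup hH⟩
  intro v hv
  rw [kCore, SimpleGraph.Subgraph.verts_sSup] at hv
  simp only [Set.mem_iUnion] at hv
  obtain ⟨H, hH, hvH⟩ := hv
  refine (hH v hvH).trans (Set.ncard_le_ncard ?_ (Set.toFinite _))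
  exact SimpleGraph.Subgraph.neighborSet_subset_of_subgraph (le_sSup hH) v

/-- The number of vertices lost from `G` when the edge `e` is deleted and the `k`-core of
`G - e` is taken. -/
def lostVertices {n : ℕ} (k : ℕ) (G : SimpleGraph (Fin n)) (e : Sym2 (Fin n)) : ℕ :=
  n - (kCore k (G.deleteEdges {e})).verts.ncard

open Classical in
/-- The simple `k`-cores with vertex set `[n]` and `m` edges. -/
def simpleCores (k n m : ℕ) : Finset (SimpleGraph (Fin n)) :=
  Finset.univ.filter fun G => G.edgeFinset.card = m ∧ ∀ v, k ≤ G.degree v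

open Classical in
/-- `P(W(G) ≥ h)` for `G` uniform on the simple `k`-cores with vertex set `[n]` and `m` edges:
the average over `G` of the proportion of edges `e` of `G` whose deletion loses at least `h`
vertices. -/
def probLost (k n m h : ℕ) : ℝ :=
  (∑ G ∈ simpleCores k n m,
      ((G.edgeFinset.filter fun e => h ≤ lostVertices k G e).card : ℝ) / (G.edgeFinset.card : ℝ))
    / ((simpleCores k n m).card : ℝ)

end CoreRobustness

end

/-! Deleting an edge at a vertex of degree `k` expels that vertex from the core, and afterwards
every neighbour of degree `k` of an expelled vertex is expelled as well (`le_lostVertices`). Only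
this part of the collapse is followed. In a random graph with prescribed degrees an unrevealed arc
leads to a vertex of degree `k` with probability about p = k N_k / 2m, where N_i is the number of
vertices of degree i, and such a vertex brings k - 1 fresh arcs. The cascade thus resembles a
branching process of mean p(k-1). If p(k-1) ≥ 1 + η, it reaches any fixed number H of vertices with
probability bounded below by a constant independent of H, and letting H grow slowly with n gives the
function h.

The comparison with a branching process is made directly on simple graphs with a fixed degree
sequence and some edges already revealed: switching two edges shows that the head of an active arc
is distributed almost like the head of a uniform arc (`active_lower`, `active_upper`). An induction
on the number of arcs still to be revealed then bounds the survival probability from s active arcs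
below by 1 - ρ^s minus an error (`spread_lower`). The error vanishes because the maximum degree is
typically O(log n) (`card_large_degree_le`).

It remains to see that typical cores are supercritical. Replacing an edge uv by uw is a reversible
move on the simple cores with m edges. Counting these moves gives n(i+1) N_{i+1} ≈ (2m - k N_k) N_i,
and a second moment argument makes this hold for most cores (`card_defect_gt_le`). The degrees are
therefore nearly Poisson truncated at k, with parameter l = c - k N_k / n; the hypothesis c ≥ k + ε
keeps l ≥ ε. For truncated Poisson degrees p(k-1) > 1 means l < k(k-2) `truncMass k l`, which says
that 1/h_k is increasing at l. This holds for l < μ_{k,c_k}. Since c_k' is the truncated Poisson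
mean at μ_{k,c_k} and that mean is monotone in the parameter, c ≤ c_k' - ε forces l below μ_{k,c_k}
with room to spare (`exists_supercritical`). -/

noncomputable section

set_option linter.unusedSectionVars false

namespace CoreRobustness

/-! ### Cascades -/

/-- Every set of vertices that contains `U` and is closed under passing to neighbours of degree `k`
has at least `H` elements. -/
def SpreadsTo {V : Type*} [Fintype V] (d : V → ℕ) (k H : ℕ) (G : SimpleGraph V)
    (U : Finset V) : Prop :=
  ∀ X : Finset V, U ⊆ X → (∀ v ∈ X, ∀ w, G.Adj v w → d w = k → w ∈ X) → H ≤ X.card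

section spread

variable {V : Type*} [Fintype V] {d : V → ℕ} {k H : ℕ} {G : SimpleGraph V} {U : Finset V}

theorem spreadsTo_of_le_card (h : H ≤ U.card) : SpreadsTo d k H G U :=
  fun _ hX _ => h.trans (Finset.card_le_card hX)

/-- Every closed set containing `U` already contains `y`, so adding `y` to the starting set changes
nothing. -/
theorem SpreadsTo.of_insert [DecidableEq V] {a y : V} (ha : a ∈ U) (hay : G.Adj a y)
    (hy : d y = k) (h : SpreadsTo d k H G (insert y U)) : SpreadsTo d k H G U := by
  intro X hX hc
  exact h X (Finset.insert_subset (hc a (hX ha) y hay hy) hX) hc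

end spread

open Classical in
/-- Deleting an edge at a vertex of degree `k` destroys everything the cascade reaches. -/
theorem le_lostVertices {n k H : ℕ} {G : SimpleGraph (Fin n)} {r : Fin n}
    (hr : G.degree r = k) {e : Sym2 (Fin n)} (he : e ∈ G.edgeSet) (hre : r ∈ e)
    (hQ : SpreadsTo (fun v => G.degree v) k H G {r}) : H ≤ lostVertices k G e := by
  set K := kCore k (G.deleteEdges {e}) with hK
  have hmin : HasMinDegree k K := (isGreatest_kCore k (G.deleteEdges {e})).1
  have hsub : ∀ v, K.neighborSet v ⊆ (G.neighborFinset v : Set (Fin n)) := by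
    intro v w hw
    have := K.adj_sub hw
    rw [SimpleGraph.deleteEdges_adj] at this
    simpa using this.1
  -- A core vertex of degree exactly `k` in `G` can spare no edge. This one fact shows both that `r`
  -- is lost and that the set of lost vertices is closed under the cascade rule.
  have hall : ∀ w, G.degree w = k → w ∈ K.verts → K.neighborSet w = (G.neighborFinset w : Set _) := by
    intro w hw hwK
    refine Set.eq_of_subset_of_ncard_le (hsub w) ?_ (Set.toFinite _)
    rw [Set.ncard_coe_finset, SimpleGraph.card_neighborFinset_eq_degree, hw]
    exact hmin w hwK
  have hcard : (Finset.univ.filter fun v => v ∉ K.verts).card = lostVertices k G e := by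
    rw [lostVertices, ← hK]
    have h1 : K.verts.ncard = (Finset.univ.filter fun v => v ∈ K.verts).card := by
      rw [← Set.ncard_coe_finset]
      congr 1
      ext v
      simp
    have h2 := Finset.card_filter_add_card_filter_not (s := (Finset.univ : Finset (Fin n)))
      (fun v => v ∈ K.verts)
    rw [Finset.card_univ, Fintype.card_fin] at h2
    omega
  rw [← hcard]
  refine hQ _ ?_ ?_
  · rw [Finset.singleton_subset_iff, Finset.mem_filter]
    refine ⟨Finset.mem_univ _, fun hrK => ?_⟩
    obtain ⟨w, rfl⟩ := hre
    have hw : w ∈ K.neighborSet r := by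
      rw [hall r hr hrK]
      simpa using he
    have := K.adj_sub hw
    rw [SimpleGraph.deleteEdges_adj] at this
    exact this.2 rfl
  · intro v hv w hvw hw
    rw [Finset.mem_filter] at hv ⊢
    refine ⟨Finset.mem_univ _, fun hwK => hv.2 ?_⟩
    have : v ∈ K.neighborSet w := by
      rw [hall w hw hwK]
      simpa using hvw.symm
    exact K.edge_vert (K.adj_symm this)

/-! ### Toggling edges -/

/-- The graph obtained from `G` by changing the status of all pairs in `T`. -/
def toggle {V : Type*} (G : SimpleGraph V) (T : Set (Sym2 V)) : SimpleGraph V where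
  Adj x y := x ≠ y ∧ (G.Adj x y ↔ s(x, y) ∉ T)
  symm := ⟨by
    intro x y h
    rw [G.adj_comm, Sym2.eq_swap]
    exact ⟨h.1.symm, h.2⟩⟩
  loopless := ⟨fun x h => h.1 rfl⟩

section toggle

variable {V : Type*}

theorem toggle_adj (G : SimpleGraph V) (T : Set (Sym2 V)) (x y : V) :
    (toggle G T).Adj x y ↔ x ≠ y ∧ (G.Adj x y ↔ s(x, y) ∉ T) := Iff.rfl

theorem toggle_toggle (G : SimpleGraph V) (T : Set (Sym2 V)) : toggle (toggle G T) T = G := by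
  ext x y
  simp only [toggle_adj]
  have := G.ne_of_adj (a := x) (b := y)
  tauto

theorem toggle_adj_of_notMem {G : SimpleGraph V} {T : Set (Sym2 V)} {x y : V}
    (h : s(x, y) ∉ T) : (toggle G T).Adj x y ↔ G.Adj x y := by
  simp only [toggle_adj]
  have := G.ne_of_adj (a := x) (b := y)
  tauto

theorem toggle_adj_of_mem {G : SimpleGraph V} {T : Set (Sym2 V)} {x y : V} (hne : x ≠ y)
    (h : s(x, y) ∈ T) : (toggle G T).Adj x y ↔ ¬ G.Adj x y := by
  simp only [toggle_adj]
  tauto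

/-- The pairs changed when the edges `ay`, `a'y'` are replaced by `ay'`, `a'y`. -/
def switchPairs (a y a' y' : V) : Set (Sym2 V) := {s(a, y), s(a', y'), s(a, y'), s(a', y)}

theorem switchPairs_comm (a y a' y' : V) : switchPairs a y' a' y = switchPairs a y a' y' := by
  ext e
  simp only [switchPairs, Set.mem_insert_iff, Set.mem_singleton_iff]
  tauto

/-- The pairs changed when the edge `uv` is replaced by `uw`. -/
def rotatePairs (u v w : V) : Set (Sym2 V) := {s(u, v), s(u, w)}

theorem rotatePairs_comm (u v w : V) : rotatePairs u w v = rotatePairs u v w := by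
  ext e
  simp only [rotatePairs, Set.mem_insert_iff, Set.mem_singleton_iff]
  tauto

/-- `ay` and `a'y'` can be replaced by `ay'` and `a'y`. -/
def Switchable (G : SimpleGraph V) (a y a' y' : V) : Prop :=
  G.Adj a y ∧ G.Adj a' y' ∧ a ≠ a' ∧ y ≠ y' ∧ a ≠ y' ∧ y ≠ a' ∧ ¬ G.Adj a y' ∧ ¬ G.Adj a' y

/-- `uv` can be replaced by `uw`. -/
def Rotatable (G : SimpleGraph V) (u v w : V) : Prop :=
  G.Adj u v ∧ u ≠ w ∧ ¬ G.Adj u w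

/-- The inverse of a switching is again a switching, with `y` and `y'` exchanged; this makes the
double counting an involution. -/
theorem Switchable.toggle {G : SimpleGraph V} {a y a' y' : V} (h : Switchable G a y a' y') :
    Switchable (toggle G (switchPairs a y a' y')) a y' a' y := by
  obtain ⟨h1, h2, h3, h4, h5, h6, h7, h8⟩ := h
  refine ⟨?_, ?_, h3, h4.symm, h1.ne, h2.ne.symm, ?_, ?_⟩
  · rwa [toggle_adj_of_mem h5 (by simp [switchPairs])]
  · rwa [toggle_adj_of_mem h6.symm (by simp [switchPairs])]
  · rw [toggle_adj_of_mem h1.ne (by simp [switchPairs])]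
    simpa using h1
  · rw [toggle_adj_of_mem h2.ne (by simp [switchPairs])]
    simpa using h2

theorem Rotatable.toggle {G : SimpleGraph V} {u v w : V} (h : Rotatable G u v w) :
    Rotatable (toggle G (rotatePairs u v w)) u w v := by
  obtain ⟨h1, h2, h3⟩ := h
  refine ⟨?_, h1.ne, ?_⟩
  · rwa [toggle_adj_of_mem h2 (by simp [rotatePairs])]
  · rw [toggle_adj_of_mem h1.ne (by simp [rotatePairs])]
    simpa using h1

end toggle

section degrees

variable {V : Type*} [Fintype V] [DecidableEq V]

open Classical in
theorem Rotatable.degree_toggle {G : SimpleGraph V} {u v w : V} (h : Rotatable G u v w) (x : V) :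
    (CoreRobustness.toggle G (rotatePairs u v w)).degree x + (if x = v then 1 else 0)
      = G.degree x + (if x = w then 1 else 0) := by
  obtain ⟨h1, h2, h3⟩ := h
  have n1 := h1.ne
  have hvw : v ≠ w := fun h => h3 (h ▸ h1)
  have c1 := G.adj_comm u v
  have c2 := G.adj_comm u w
  have e1 : ∀ z, (CoreRobustness.toggle G (rotatePairs u v w)).Adj x z ↔ x ≠ z ∧
      (G.Adj x z ↔ ¬ (((x = u ∧ z = v) ∨ (x = v ∧ z = u)) ∨ ((x = u ∧ z = w) ∨ (x = w ∧ z = u)))) := by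
    intro z
    rw [toggle_adj]
    simp only [rotatePairs, Set.mem_insert_iff, Set.mem_singleton_iff, Sym2.eq_iff]
  rw [← SimpleGraph.card_neighborFinset_eq_degree, ← SimpleGraph.card_neighborFinset_eq_degree]
  by_cases xv : x = v
  · subst xv
    have : G.neighborFinset x = insert u
        ((CoreRobustness.toggle G (rotatePairs u x w)).neighborFinset x) := by
      ext z
      simp only [SimpleGraph.mem_neighborFinset, Finset.mem_insert, e1]
      have := G.ne_of_adj (a := x) (b := z)
      by_cases x1 : z = u
      · subst x1; tauto
      · tauto
    rw [this, Finset.card_insert_of_notMem]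
    · simp [hvw]
    · simp only [SimpleGraph.mem_neighborFinset, e1]
      tauto
  by_cases xw : x = w
  · subst xw
    have : (CoreRobustness.toggle G (rotatePairs u v x)).neighborFinset x
        = insert u (G.neighborFinset x) := by
      ext z
      simp only [SimpleGraph.mem_neighborFinset, Finset.mem_insert, e1]
      have := G.ne_of_adj (a := x) (b := z)
      by_cases x1 : z = u
      · subst x1; tauto
      · tauto
    rw [this, Finset.card_insert_of_notMem]
    · simp [xv]
    · simp only [SimpleGraph.mem_neighborFinset]
      tauto
  by_cases xu : x = u
  · subst xu
    have : (CoreRobustness.toggle G (rotatePairs x v w)).neighborFinset x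
        = insert w ((G.neighborFinset x).erase v) := by
      ext z
      simp only [SimpleGraph.mem_neighborFinset, Finset.mem_insert, Finset.mem_erase, e1]
      have := G.ne_of_adj (a := x) (b := z)
      by_cases x1 : z = v
      · subst x1; tauto
      · by_cases x2 : z = w
        · subst x2; tauto
        · tauto
    have hpos : 0 < (G.neighborFinset x).card := Finset.card_pos.2 ⟨v, by simpa using h1⟩
    rw [this, Finset.card_insert_of_notMem (by simp [h3]),
      Finset.card_erase_of_mem (by simpa using h1)]
    simp only [xv, xw, if_false]
    omega
  simp only [xv, xw, if_false, add_zero]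
  congr 1
  ext z
  simp only [SimpleGraph.mem_neighborFinset, e1]
  have := G.ne_of_adj (a := x) (b := z)
  tauto

open Classical in
-- A switching is the composition of two rotations on disjoint sets of pairs, and their degree
-- changes at `y` and `y'` cancel.
theorem Switchable.degree_toggle {G : SimpleGraph V} {a y a' y' : V} (h : Switchable G a y a' y')
    (v : V) : (CoreRobustness.toggle G (switchPairs a y a' y')).degree v = G.degree v := by
  obtain ⟨h1, h2, h3, h4, h5, h6, h7, h8⟩ := h
  have r1 : Rotatable G a y y' := ⟨h1, h5, h7⟩
  have n1 : s(a', y') ∉ rotatePairs a y y' := by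
    simp [rotatePairs, h3.symm, h4.symm, h5.symm]
  have n2 : s(a', y) ∉ rotatePairs a y y' := by
    simp [rotatePairs, h3.symm, h4, h6.symm, h1.ne.symm]
  have r2 : Rotatable (CoreRobustness.toggle G (rotatePairs a y y')) a' y' y :=
    ⟨(toggle_adj_of_notMem n1).2 h2, h6.symm, fun h => h8 ((toggle_adj_of_notMem n2).1 h)⟩
  have e : CoreRobustness.toggle (CoreRobustness.toggle G (rotatePairs a y y'))
      (rotatePairs a' y' y) = CoreRobustness.toggle G (switchPairs a y a' y') := by
    ext p q
    have hpq : s(p, q) ∈ switchPairs a y a' y' ↔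
        (s(p, q) ∈ rotatePairs a y y' ∨ s(p, q) ∈ rotatePairs a' y' y) := by
      simp only [switchPairs, rotatePairs, Set.mem_insert_iff, Set.mem_singleton_iff]
      tauto
    have hdis : s(p, q) ∈ rotatePairs a' y' y → s(p, q) ∉ rotatePairs a y y' := by
      intro hq
      simp only [rotatePairs, Set.mem_insert_iff, Set.mem_singleton_iff] at hq
      rcases hq with hq | hq <;> rw [hq] <;> assumption
    simp only [toggle_adj]
    tauto
  have d1 := r1.degree_toggle v
  have d2 := r2.degree_toggle v
  rw [e] at d2
  omega

end degrees

/-! ### Switchings in a fixed degree class -/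

section switching

open Classical

variable {V : Type*} [Fintype V] [DecidableEq V]

/-- The graphs with degree sequence `d` that contain the edges in `E`. -/
def degClass (d : V → ℕ) (E : Finset (Sym2 V)) : Finset (SimpleGraph V) :=
  Finset.univ.filter fun G => (∀ v, G.degree v = d v) ∧ ∀ e ∈ E, e ∈ G.edgeSet

/-- The directed edges of `G`. -/
def arcs (G : SimpleGraph V) : Finset (V × V) :=
  Finset.univ.filter fun q => G.Adj q.1 q.2

/-- The directed edges of `G` that start in `U` and are not in `E`. -/
def active (G : SimpleGraph V) (U : Finset V) (E : Finset (Sym2 V)) : Finset (V × V) :=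
  Finset.univ.filter fun q => q.1 ∈ U ∧ G.Adj q.1 q.2 ∧ s(q.1, q.2) ∉ E

theorem mem_degClass {d : V → ℕ} {E : Finset (Sym2 V)} {G : SimpleGraph V} :
    G ∈ degClass d E ↔ (∀ v, G.degree v = d v) ∧ ∀ e ∈ E, e ∈ G.edgeSet := by
  simp [degClass]

theorem mem_arcs {G : SimpleGraph V} {q : V × V} : q ∈ arcs G ↔ G.Adj q.1 q.2 := by
  simp [arcs]

theorem mem_active {G : SimpleGraph V} {U : Finset V} {E : Finset (Sym2 V)} {q : V × V} :
    q ∈ active G U E ↔ q.1 ∈ U ∧ G.Adj q.1 q.2 ∧ s(q.1, q.2) ∉ E := by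
  simp [active]

theorem card_filter_prod {α β : Type*} (A : Finset α) (B : Finset β) (p : α × β → Prop)
    [DecidablePred p] :
    ((A ×ˢ B).filter p).card = ∑ a ∈ A, (B.filter fun b => p (a, b)).card := by
  simp only [Finset.card_filter]
  exact Finset.sum_product _ _ _

theorem card_arcs_filter_fst (G : SimpleGraph V) (P : V → Prop)
    [DecidablePred P] :
    ((arcs G).filter fun q => P q.1).card = ∑ v with P v, G.degree v := by
  have : (arcs G).filter (fun q => P q.1)
      = ((Finset.univ : Finset V) ×ˢ (Finset.univ : Finset V)).filter
        (fun q => P q.1 ∧ G.Adj q.1 q.2) := by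
    ext q; simp [mem_arcs, and_comm]
  rw [this, card_filter_prod, Finset.sum_filter]
  refine Finset.sum_congr rfl fun v _ => ?_
  split_ifs with h
  · rw [← SimpleGraph.card_neighborFinset_eq_degree]
    congr 1
    ext w
    simp [h]
  · simp [h]

theorem card_arcs_filter_snd (G : SimpleGraph V) (P : V → Prop)
    [DecidablePred P] :
    ((arcs G).filter fun q => P q.2).card = ∑ v with P v, G.degree v := by
  rw [← card_arcs_filter_fst]
  refine Finset.card_nbij' Prod.swap Prod.swap ?_ ?_ (fun _ _ => rfl) (fun _ _ => rfl)
  all_goals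
    intro q hq
    simp only [Finset.mem_coe, Finset.mem_filter, mem_arcs] at hq ⊢
    exact ⟨hq.1.symm, hq.2⟩

theorem card_arcs (G : SimpleGraph V) : (arcs G).card = ∑ v, G.degree v := by
  simpa using card_arcs_filter_fst G (fun _ => True)

theorem card_arcs_fst_le {G : SimpleGraph V} {Δ : ℕ} (hΔ : ∀ v, G.degree v ≤ Δ) (x : V) :
    ((arcs G).filter fun q => q.1 = x).card ≤ Δ := by
  rw [card_arcs_filter_fst G (fun v => v = x)]
  simpa [Finset.filter_eq'] using hΔ x

theorem card_arcs_snd_le {G : SimpleGraph V} {Δ : ℕ} (hΔ : ∀ v, G.degree v ≤ Δ) (x : V) :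
    ((arcs G).filter fun q => q.2 = x).card ≤ Δ := by
  rw [card_arcs_filter_snd G (fun v => v = x)]
  simpa [Finset.filter_eq'] using hΔ x

theorem card_arcs_adj_fst_le {G : SimpleGraph V} {Δ : ℕ} (hΔ : ∀ v, G.degree v ≤ Δ) (x : V) :
    ((arcs G).filter fun q => G.Adj x q.1).card ≤ Δ * Δ := by
  rw [card_arcs_filter_fst G (fun v => G.Adj x v)]
  refine (Finset.sum_le_card_nsmul _ _ Δ fun v _ => hΔ v).trans ?_
  have : (Finset.univ.filter (G.Adj x)) = G.neighborFinset x := by ext; simp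
  rw [this, SimpleGraph.card_neighborFinset_eq_degree, smul_eq_mul]
  exact Nat.mul_le_mul_right _ (hΔ x)

theorem card_arcs_adj_snd_le {G : SimpleGraph V} {Δ : ℕ} (hΔ : ∀ v, G.degree v ≤ Δ) (x : V) :
    ((arcs G).filter fun q => G.Adj x q.2).card ≤ Δ * Δ := by
  rw [card_arcs_filter_snd G (fun v => G.Adj x v), ← card_arcs_filter_fst G (fun v => G.Adj x v)]
  exact card_arcs_adj_fst_le hΔ x

theorem card_arcs_edge_le (G : SimpleGraph V) (E : Finset (Sym2 V)) :
    ((arcs G).filter fun q => s(q.1, q.2) ∈ E).card ≤ 2 * E.card := by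
  refine (Finset.card_le_mul_card_image_of_maps_to (f := fun q : V × V => s(q.1, q.2)) (t := E)
    (fun q hq => (Finset.mem_filter.1 hq).2) 2 ?_).trans (by rw [mul_comm])
  intro e _
  induction e with
  | _ x y =>
    refine (Finset.card_le_card (t := {(x, y), (y, x)}) ?_).trans Finset.card_le_two
    rintro ⟨p, q⟩ hq
    have := (Finset.mem_filter.1 hq).2
    rw [Sym2.eq_iff] at this
    simpa using this

/-- The number of arcs that cannot be switched with a given arc. -/
def switchLoss (e Δ : ℕ) : ℕ := 2 * e + 4 * Δ + 2 * (Δ * Δ)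

/-- An obstructing arc is revealed, has an end at `a` or `y`, has its head adjacent to `a`, or has
its tail adjacent to `y`. These cases account for the three terms of `switchLoss`. -/
theorem card_not_switchable_le {G : SimpleGraph V} {Δ : ℕ} (hΔ : ∀ v, G.degree v ≤ Δ)
    (E : Finset (Sym2 V)) {a y : V} (hay : G.Adj a y) :
    ((arcs G).filter fun q => ¬ (Switchable G a y q.1 q.2 ∧ s(q.1, q.2) ∉ E)).card
      ≤ switchLoss E.card Δ := by
  have hsub : ((arcs G).filter fun q => ¬ (Switchable G a y q.1 q.2 ∧ s(q.1, q.2) ∉ E)) ⊆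
      ((arcs G).filter fun q => s(q.1, q.2) ∈ E) ∪ (((arcs G).filter fun q => q.1 = a) ∪
      (((arcs G).filter fun q => q.1 = y) ∪ (((arcs G).filter fun q => q.2 = a) ∪
      (((arcs G).filter fun q => q.2 = y) ∪ (((arcs G).filter fun q => G.Adj a q.2) ∪
      ((arcs G).filter fun q => G.Adj y q.1)))))) := by
    intro q hq
    rw [Finset.mem_filter] at hq
    simp only [Finset.mem_union, Finset.mem_filter, hq.1, true_and]
    have h1 := mem_arcs.1 hq.1
    have h2 := hq.2
    have c := G.adj_comm y q.1
    simp only [Switchable, h1, hay, true_and, ne_eq] at h2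
    have e1 : a = q.1 ↔ q.1 = a := eq_comm
    have e2 : y = q.1 ↔ q.1 = y := eq_comm
    have e3 : a = q.2 ↔ q.2 = a := eq_comm
    have e4 : y = q.2 ↔ q.2 = y := eq_comm
    tauto
  refine (Finset.card_le_card hsub).trans ?_
  have u1 := card_arcs_edge_le G E
  have u2 := card_arcs_fst_le hΔ a
  have u3 := card_arcs_fst_le hΔ y
  have u4 := card_arcs_snd_le hΔ a
  have u5 := card_arcs_snd_le hΔ y
  have u6 := card_arcs_adj_snd_le hΔ a
  have u7 := card_arcs_adj_fst_le hΔ y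
  refine (Finset.card_union_le _ _).trans ?_
  refine (Nat.add_le_add_left (Finset.card_union_le _ _) _).trans ?_
  refine (Nat.add_le_add_left (Nat.add_le_add_left (Finset.card_union_le _ _) _) _).trans ?_
  refine (Nat.add_le_add_left (Nat.add_le_add_left (Nat.add_le_add_left
    (Finset.card_union_le _ _) _) _) _).trans ?_
  refine (Nat.add_le_add_left (Nat.add_le_add_left (Nat.add_le_add_left (Nat.add_le_add_left
    (Finset.card_union_le _ _) _) _) _) _).trans ?_
  refine (Nat.add_le_add_left (Nat.add_le_add_left (Nat.add_le_add_left (Nat.add_le_add_left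
    (Nat.add_le_add_left (Finset.card_union_le _ _) _) _) _) _) _).trans ?_
  rw [switchLoss]
  omega

/-- The admissible switchings of an active arc with another arc. -/
def switchings (d : V → ℕ) (U : Finset V) (E : Finset (Sym2 V)) (P : (V × V) × (V × V) → Prop)
    [DecidablePred P] :
    Finset (Σ _ : SimpleGraph V, (V × V) × (V × V)) :=
  (degClass d E).sigma fun G => ((active G U E) ×ˢ (arcs G)).filter fun t =>
    (Switchable G t.1.1 t.1.2 t.2.1 t.2.2 ∧ s(t.2.1, t.2.2) ∉ E) ∧ P t

theorem mem_switchings {d : V → ℕ} {U : Finset V} {E : Finset (Sym2 V)}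
    {P : (V × V) × (V × V) → Prop} [DecidablePred P]
    {G : SimpleGraph V} {a y a' y' : V} :
    (⟨G, ((a, y), (a', y'))⟩ : Σ _ : SimpleGraph V, (V × V) × (V × V)) ∈ switchings d U E P ↔
      (∀ v, G.degree v = d v) ∧ (∀ e ∈ E, e ∈ G.edgeSet) ∧ a ∈ U ∧ s(a, y) ∉ E ∧
        Switchable G a y a' y' ∧ s(a', y') ∉ E ∧ P ((a, y), (a', y')) := by
  simp only [switchings, Finset.mem_sigma, mem_degClass, Finset.mem_filter, Finset.mem_product,
    mem_active, mem_arcs]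
  simp only [Switchable]
  tauto

/-- Revealed edges survive because the removed edges are outside `E`; the added pairs are outside
`E` because they were not edges of `G`. -/
theorem switchings_toggle {d : V → ℕ} {U : Finset V} {E : Finset (Sym2 V)}
    {G : SimpleGraph V} {a y a' y' : V}
    (h : (∀ v, G.degree v = d v) ∧ (∀ e ∈ E, e ∈ G.edgeSet) ∧ a ∈ U ∧ s(a, y) ∉ E ∧
        Switchable G a y a' y' ∧ s(a', y') ∉ E) :
    (∀ v, (toggle G (switchPairs a y a' y')).degree v = d v) ∧
      (∀ e ∈ E, e ∈ (toggle G (switchPairs a y a' y')).edgeSet) ∧ a ∈ U ∧ s(a, y') ∉ E ∧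
        Switchable (toggle G (switchPairs a y a' y')) a y' a' y ∧ s(a', y) ∉ E := by
  obtain ⟨h1, h2, h3, h4, h5, h6⟩ := h
  have n1 : s(a, y') ∉ E := fun h => h5.2.2.2.2.2.2.1 (by simpa using h2 _ h)
  have n2 : s(a', y) ∉ E := fun h => h5.2.2.2.2.2.2.2 (by simpa using h2 _ h)
  refine ⟨fun v => by rw [h5.degree_toggle, h1 v], ?_, h3, n1, h5.toggle, n2⟩
  intro e he
  have hT : e ∉ switchPairs a y a' y' := by
    simp only [switchPairs, Set.mem_insert_iff, Set.mem_singleton_iff]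
    rintro (rfl | rfl | rfl | rfl) <;> contradiction
  induction e with
  | _ p q =>
    rw [SimpleGraph.mem_edgeSet, toggle_adj_of_notMem hT]
    simpa using h2 _ he

/-- The switching involution exchanges the two heads. This transfers the law of the head of a
uniform arc to the head of an active arc. -/
theorem card_switchings_comm (d : V → ℕ) (U : Finset V) (E : Finset (Sym2 V)) (P : V → Prop)
    [DecidablePred P] :
    (switchings d U E fun t => P t.1.2).card = (switchings d U E fun t => P t.2.2).card := by
  let f : (Σ _ : SimpleGraph V, (V × V) × (V × V)) → (Σ _ : SimpleGraph V, (V × V) × (V × V)) :=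
    fun x => ⟨toggle x.1 (switchPairs x.2.1.1 x.2.1.2 x.2.2.1 x.2.2.2),
      ((x.2.1.1, x.2.2.2), (x.2.2.1, x.2.1.2))⟩
  have hf : ∀ x, f (f x) = x := by
    rintro ⟨G, ⟨⟨a, y⟩, ⟨a', y'⟩⟩⟩
    simp only [f]
    rw [switchPairs_comm, toggle_toggle]
  refine Finset.card_nbij' f f ?_ ?_ (fun x _ => hf x) (fun x _ => hf x)
  · rintro ⟨G, ⟨⟨a, y⟩, ⟨a', y'⟩⟩⟩ hx
    rw [Finset.mem_coe, mem_switchings] at hx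
    obtain ⟨h1, h2, h3, h4, h5, h6, h7⟩ := hx
    obtain ⟨g1, g2, g3, g4, g5, g6⟩ := switchings_toggle ⟨h1, h2, h3, h4, h5, h6⟩
    exact mem_switchings.2 ⟨g1, g2, g3, g4, g5, g6, h7⟩
  · rintro ⟨G, ⟨⟨a, y⟩, ⟨a', y'⟩⟩⟩ hx
    rw [Finset.mem_coe, mem_switchings] at hx
    obtain ⟨h1, h2, h3, h4, h5, h6, h7⟩ := hx
    obtain ⟨g1, g2, g3, g4, g5, g6⟩ := switchings_toggle ⟨h1, h2, h3, h4, h5, h6⟩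
    exact mem_switchings.2 ⟨g1, g2, g3, g4, g5, g6, h7⟩

theorem card_le_switchings {d : V → ℕ} {Δ : ℕ} (hΔ : ∀ v, d v ≤ Δ) (U : Finset V)
    (E : Finset (Sym2 V)) (P : (V × V) × (V × V) → Prop)
    [DecidablePred P] :
    ∑ G ∈ degClass d E, (((active G U E) ×ˢ (arcs G)).filter P).card
      ≤ (switchings d U E P).card
        + switchLoss E.card Δ * ∑ G ∈ degClass d E, (active G U E).card := by
  rw [switchings, Finset.card_sigma, Finset.mul_sum, ← Finset.sum_add_distrib]
  refine Finset.sum_le_sum fun G hG => ?_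
  have hdeg := (mem_degClass.1 hG).1
  have h1 : (((active G U E) ×ˢ (arcs G)).filter P) ⊆
      (((active G U E) ×ˢ (arcs G)).filter fun t =>
        (Switchable G t.1.1 t.1.2 t.2.1 t.2.2 ∧ s(t.2.1, t.2.2) ∉ E) ∧ P t) ∪
      (((active G U E) ×ˢ (arcs G)).filter fun t =>
        ¬ (Switchable G t.1.1 t.1.2 t.2.1 t.2.2 ∧ s(t.2.1, t.2.2) ∉ E)) := by
    intro t ht
    rw [Finset.mem_filter] at ht
    rw [Finset.mem_union, Finset.mem_filter, Finset.mem_filter]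
    have := ht.1
    have := ht.2
    tauto
  refine (Finset.card_le_card h1).trans ((Finset.card_union_le _ _).trans ?_)
  refine Nat.add_le_add_left ?_ _
  rw [card_filter_prod, mul_comm, ← smul_eq_mul]
  refine Finset.sum_le_card_nsmul _ _ _ fun q hq => ?_
  exact card_not_switchable_le (fun v => (hdeg v).le.trans (hΔ v)) E (mem_active.1 hq).2.1

theorem switchings_card_le (d : V → ℕ) (U : Finset V)
    (E : Finset (Sym2 V)) (P : (V × V) × (V × V) → Prop)
    [DecidablePred P] :
    (switchings d U E P).card ≤
      ∑ G ∈ degClass d E, (((active G U E) ×ˢ (arcs G)).filter P).card := by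
  rw [switchings, Finset.card_sigma]
  refine Finset.sum_le_sum fun G _ => Finset.card_le_card ?_
  intro t ht
  rw [Finset.mem_filter] at ht ⊢
  exact ⟨ht.1, ht.2.2⟩

theorem sum_card_active_fst (d : V → ℕ) (U : Finset V) (E : Finset (Sym2 V)) (P : V → Prop)
    [DecidablePred P] :
    ∑ G ∈ degClass d E, (((active G U E) ×ˢ (arcs G)).filter fun t => P t.1.2).card
      = (∑ v, d v) * ∑ G ∈ degClass d E, ((active G U E).filter fun q => P q.2).card := by
  rw [Finset.mul_sum]
  refine Finset.sum_congr rfl fun G hG => ?_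
  have hdeg := (mem_degClass.1 hG).1
  rw [card_filter_prod, Finset.card_filter, Finset.mul_sum]
  refine Finset.sum_congr rfl fun q _ => ?_
  by_cases h : P q.2
  · simp [h, card_arcs, hdeg]
  · simp [h]

theorem sum_card_active_snd (d : V → ℕ) (U : Finset V) (E : Finset (Sym2 V)) (P : V → Prop)
    [DecidablePred P] :
    ∑ G ∈ degClass d E, (((active G U E) ×ˢ (arcs G)).filter fun t => P t.2.2).card
      = (∑ v with P v, d v) * ∑ G ∈ degClass d E, (active G U E).card := by
  rw [Finset.mul_sum]
  refine Finset.sum_congr rfl fun G hG => ?_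
  have hdeg := (mem_degClass.1 hG).1
  rw [card_filter_prod, Finset.sum_congr rfl (g := fun _ => ∑ v with P v, d v), Finset.sum_const,
    smul_eq_mul, mul_comm]
  intro q _
  rw [card_arcs_filter_snd]
  exact Finset.sum_congr rfl fun v _ => hdeg v

/-- In a random graph of the class, the head of an active arc has property `P` with at least the
probability that the head of a uniform arc does, up to a small error. -/
theorem active_lower {d : V → ℕ} {Δ : ℕ} (hΔ : ∀ v, d v ≤ Δ) (U : Finset V)
    (E : Finset (Sym2 V)) (P : V → Prop)
    [DecidablePred P] :
    (∑ v with P v, d v) * ∑ G ∈ degClass d E, (active G U E).card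
      ≤ (∑ v, d v) * ∑ G ∈ degClass d E, ((active G U E).filter fun q => P q.2).card
        + switchLoss E.card Δ * ∑ G ∈ degClass d E, (active G U E).card := by
  rw [← sum_card_active_snd, ← sum_card_active_fst]
  refine (card_le_switchings hΔ U E _).trans (Nat.add_le_add_right ?_ _)
  rw [← card_switchings_comm]
  exact switchings_card_le _ _ _ _

/-- The mirror image of `active_lower`. It is applied to the property of lying in `U`, to bound the
chance that the exploration runs into itself. -/
theorem active_upper {d : V → ℕ} {Δ : ℕ} (hΔ : ∀ v, d v ≤ Δ) (U : Finset V)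
    (E : Finset (Sym2 V)) (P : V → Prop)
    [DecidablePred P] :
    (∑ v, d v) * ∑ G ∈ degClass d E, ((active G U E).filter fun q => P q.2).card
      ≤ (∑ v with P v, d v) * ∑ G ∈ degClass d E, (active G U E).card
        + switchLoss E.card Δ * ∑ G ∈ degClass d E, (active G U E).card := by
  rw [← sum_card_active_snd, ← sum_card_active_fst]
  refine (card_le_switchings hΔ U E _).trans (Nat.add_le_add_right ?_ _)
  rw [card_switchings_comm]
  exact switchings_card_le _ _ _ _

end switching

/-! ### Exploration of the cascade -/

section exploration

open Classical

variable {V : Type*} [Fintype V] [DecidableEq V]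

/-- The explored vertices after an arc with head `y` has been revealed. -/
def explore (d : V → ℕ) (k : ℕ) (U : Finset V) (y : V) : Finset V :=
  if d y = k then insert y U else U

theorem mem_degClass_insert {d : V → ℕ} {E : Finset (Sym2 V)} {G : SimpleGraph V} {q : V × V} :
    G ∈ degClass d (insert s(q.1, q.2) E) ↔ G ∈ degClass d E ∧ G.Adj q.1 q.2 := by
  simp only [mem_degClass, Finset.forall_mem_insert, SimpleGraph.mem_edgeSet]
  tauto

/-- A head of degree other than `k` stops the cascade along this arc: the walk moves by -1. -/
theorem card_active_explore_of_ne {d : V → ℕ} {k : ℕ} {U : Finset V} {E : Finset (Sym2 V)}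
    {G : SimpleGraph V} {a y : V} (ha : a ∈ U) (hy : y ∉ U) (hE : s(a, y) ∉ E)
    (hay : G.Adj a y) (hd : d y ≠ k) :
    (active G (explore d k U y) (insert s(a, y) E)).card + 1 = (active G U E).card := by
  have : active G (explore d k U y) (insert s(a, y) E) = (active G U E).erase (a, y) := by
    ext ⟨p, q⟩
    simp only [explore, hd, if_false, mem_active, Finset.mem_erase, Finset.mem_insert, Sym2.eq_iff,
      Prod.mk.injEq, ne_eq]
    have : p ∈ U → p ≠ y := fun h h' => hy (h' ▸ h)
    tauto
  rw [this]
  exact Finset.card_erase_add_one (mem_active.2 ⟨ha, hay, hE⟩)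

/-- The walk moves by `k - 2`: one arc is used up, and the other `k - 1` arcs at `y` become active.
They are all unrevealed, because by `hinv` a revealed edge at `y` would have put `y` into `U`
earlier. -/
theorem card_active_explore_of_eq {d : V → ℕ} {k : ℕ} {U : Finset V} {E : Finset (Sym2 V)}
    {G : SimpleGraph V} {a y : V} (ha : a ∈ U) (hy : y ∉ U) (hE : s(a, y) ∉ E)
    (hinv : ∀ e ∈ E, ∀ v ∈ e, d v = k → v ∈ U)
    (hay : G.Adj a y) (hd : d y = k) (hG : G.degree y = d y) :
    (active G (explore d k U y) (insert s(a, y) E)).card + 2 = (active G U E).card + k := by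
  have hnot : ∀ z, s(y, z) ∉ E := fun z hz => hy (hinv _ hz y (Sym2.mem_mk_left _ _) hd)
  have : active G (explore d k U y) (insert s(a, y) E) =
      (active G U E).erase (a, y) ∪ ((G.neighborFinset y).erase a).image (fun z => (y, z)) := by
    ext ⟨p, q⟩
    simp only [explore, hd, if_true, mem_active, Finset.mem_erase, Finset.mem_insert, Sym2.eq_iff,
      Prod.mk.injEq, ne_eq, Finset.mem_union, Finset.mem_image, SimpleGraph.mem_neighborFinset]
    have h1 : p ∈ U → p ≠ y := fun h h' => hy (h' ▸ h)
    have h2 : a ≠ y := hay.ne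
    by_cases hp : p = y
    · subst hp
      have := hnot q
      constructor
      · rintro ⟨-, h3, h4⟩
        refine Or.inr ⟨q, ⟨?_, h3⟩, rfl, rfl⟩
        tauto
      · rintro (h | ⟨z, ⟨h3, h4⟩, -, rfl⟩)
        · exact absurd h.2.1 hy
        · tauto
    · constructor
      · tauto
      · rintro (h | ⟨z, -, h3, -⟩)
        · tauto
        · exact absurd h3.symm hp
  have hmem : (a, y) ∈ active G U E := mem_active.2 ⟨ha, hay, hE⟩
  have hmem' : a ∈ G.neighborFinset y := by simpa using hay.symm
  have c1 := Finset.card_erase_add_one hmem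
  have c2 := Finset.card_erase_add_one hmem'
  rw [SimpleGraph.card_neighborFinset_eq_degree, hG, hd] at c2
  rw [this, Finset.card_union_of_disjoint, Finset.card_image_of_injective]
  · omega
  · intro z z' h
    simpa using h
  · rw [Finset.disjoint_left]
    rintro ⟨p, q⟩ h1 h2
    simp only [Finset.mem_image, Prod.mk.injEq] at h2
    obtain ⟨z, -, rfl, -⟩ := h2
    exact hy (mem_active.1 (Finset.mem_of_mem_erase h1)).1

theorem SpreadsTo.of_explore {d : V → ℕ} {k H : ℕ} {G : SimpleGraph V} {U : Finset V} {a y : V}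
    (ha : a ∈ U) (hay : G.Adj a y) (h : SpreadsTo d k H G (explore d k U y)) :
    SpreadsTo d k H G U := by
  rw [explore] at h
  split_ifs at h with hy
  · exact h.of_insert ha hay hy
  · exact h

/-- Revealing one arc: the number of spreading graphs in terms of the classes with one more
known edge. -/
theorem sum_explore_le (d : V → ℕ) (k H s : ℕ) (U : Finset V) (E : Finset (Sym2 V))
    (hs : ∀ G ∈ degClass d E, (active G U E).card = s) (w : V → ℝ)
    (hw : ∀ a y, a ∈ U → y ∉ U → s(a, y) ∉ E →
      w y * ((degClass d (insert s(a, y) E)).card : ℝ) ≤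
        ((degClass d (insert s(a, y) E)).filter
          fun G => SpreadsTo d k H G (explore d k U y)).card) :
    ∑ G ∈ degClass d E, ∑ q ∈ (active G U E).filter (fun q => q.2 ∉ U), w q.2
      ≤ s * ((degClass d E).filter fun G => SpreadsTo d k H G U).card := by
  set R : Finset (V × V) :=
    Finset.univ.filter fun q => q.1 ∈ U ∧ q.2 ∉ U ∧ s(q.1, q.2) ∉ E with hR
  -- Pairs of a graph and an active arc leaving `U` are regrouped by the arc; the graphs containing
  -- that arc form exactly the class with one more revealed edge.
  have swap : ∀ f : SimpleGraph V → V × V → ℝ,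
      ∑ G ∈ degClass d E, ∑ q ∈ (active G U E).filter (fun q => q.2 ∉ U), f G q
        = ∑ q ∈ R, ∑ G ∈ degClass d (insert s(q.1, q.2) E), f G q := by
    intro f
    refine Finset.sum_comm' ?_
    intro G q
    rw [mem_degClass_insert, hR, Finset.mem_filter, Finset.mem_filter, mem_active]
    simp only [Finset.mem_univ, true_and]
    tauto
  rw [swap (fun _ q => w q.2)]
  calc ∑ q ∈ R, ∑ _G ∈ degClass d (insert s(q.1, q.2) E), w q.2
      ≤ ∑ q ∈ R, ∑ G ∈ degClass d (insert s(q.1, q.2) E),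
          (if SpreadsTo d k H G (explore d k U q.2) then (1 : ℝ) else 0) := by
        refine Finset.sum_le_sum fun q hq => ?_
        obtain ⟨-, h1, h2, h3⟩ := Finset.mem_filter.1 hq
        rw [Finset.sum_const, nsmul_eq_mul, mul_comm, Finset.sum_boole]
        exact hw _ _ h1 h2 h3
    _ = ∑ G ∈ degClass d E, ∑ q ∈ (active G U E).filter (fun q => q.2 ∉ U),
          (if SpreadsTo d k H G (explore d k U q.2) then (1 : ℝ) else 0) :=
        (swap fun G q => if SpreadsTo d k H G (explore d k U q.2) then (1 : ℝ) else 0).symm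
    _ ≤ ∑ G ∈ degClass d E, ∑ q ∈ active G U E,
          (if SpreadsTo d k H G U then (1 : ℝ) else 0) := by
        refine Finset.sum_le_sum fun G _ => ?_
        refine (Finset.sum_le_sum (g := fun _ => if SpreadsTo d k H G U then (1 : ℝ) else 0)
          fun q hq => ?_).trans
          (Finset.sum_le_sum_of_subset_of_nonneg (Finset.filter_subset _ _) fun q _ _ => ?_)
        · obtain ⟨h1, h2, -⟩ := mem_active.1 (Finset.mem_filter.1 hq).1
          by_cases h : SpreadsTo d k H G (explore d k U q.2)
          · rw [if_pos h, if_pos (h.of_explore h1 h2)]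
          · rw [if_neg h]
            split_ifs <;> norm_num
        · split_ifs <;> norm_num
    _ = s * ((degClass d E).filter fun G => SpreadsTo d k H G U).card := by
        rw [← Finset.sum_boole, Finset.mul_sum]
        refine Finset.sum_congr rfl fun G hG => ?_
        rw [Finset.sum_const, hs G hG, nsmul_eq_mul]

/-- The weight of the active arcs that lead out of `U`, for a weight that depends only on whether
the head has degree `k`. -/
theorem sum_active_filter {d : V → ℕ} {k : ℕ} {U : Finset V} (hU : ∀ u ∈ U, d u = k)
    (E : Finset (Sym2 V)) (G : SimpleGraph V) (g₁ g₀ : ℝ) :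
    ∑ q ∈ (active G U E).filter (fun q => q.2 ∉ U), (if d q.2 = k then g₁ else g₀)
      = (((active G U E).filter fun q => d q.2 = k).card
          - ((active G U E).filter fun q => q.2 ∈ U).card : ℝ) * g₁
        + ((active G U E).card - ((active G U E).filter fun q => d q.2 = k).card : ℝ) * g₀ := by
  have h1 : ∀ q : V × V, (if q.2 ∉ U then (if d q.2 = k then g₁ else g₀) else 0)
      = ((if d q.2 = k then (1 : ℝ) else 0) - (if q.2 ∈ U then (1 : ℝ) else 0)) * g₁
        + (1 - (if d q.2 = k then (1 : ℝ) else 0)) * g₀ := by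
    intro q
    by_cases h : q.2 ∈ U
    · simp [h, hU _ h]
    · by_cases h' : d q.2 = k <;> simp [h, h']
  rw [Finset.sum_filter, Finset.sum_congr rfl fun q _ => h1 q, Finset.sum_add_distrib,
    ← Finset.sum_mul, ← Finset.sum_mul, Finset.sum_sub_distrib, Finset.sum_sub_distrib,
    Finset.sum_boole, Finset.sum_boole, Finset.sum_const, nsmul_eq_mul, mul_one]

/-- The survival estimate for one step of a random walk with increments `k - 2` and `-1`. -/
theorem walk_step {A C Tot M L u ρ p θ loss jθ : ℝ} {k s : ℕ} (hρ0 : 0 ≤ ρ)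
    (hρ1 : ρ ≤ 1) (hM : 0 < M) (hT : 0 ≤ Tot) (hC0 : 0 ≤ C) (hjθ : 0 ≤ jθ)
    (hloss : 0 ≤ loss) (hp : p * M = L) (hroot : p * ρ ^ (k - 1) + 1 - p ≤ ρ)
    (hA : L * Tot ≤ M * A + loss * Tot) (hC : M * C ≤ u * Tot + loss * Tot)
    (hθ : u + 2 * loss ≤ θ * M) :
    (1 - ρ ^ (s + 1) - (jθ + θ)) * Tot ≤
      (A - C) * (1 - ρ ^ (s + (k - 1)) - jθ) + (Tot - A) * (1 - ρ ^ s - jθ) := by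
  have hA' : p * Tot - loss / M * Tot ≤ A := by
    have : p * Tot - loss / M * Tot = (L * Tot - loss * Tot) / M := by
      rw [← hp]; field_simp
    rw [this, div_le_iff₀ hM]
    linarith
  have hC' : C ≤ (u + loss) / M * Tot := by
    have : (u + loss) / M * Tot = (u * Tot + loss * Tot) / M := by field_simp
    rw [this, le_div_iff₀ hM]
    linarith
  have hθ' : (u + loss) / M + loss / M ≤ θ := by
    rw [← add_div, div_le_iff₀ hM]
    linarith
  have hx0 : 0 ≤ ρ ^ s := pow_nonneg hρ0 s
  have hx1 : ρ ^ s ≤ 1 := pow_le_one₀ hρ0 hρ1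
  have hy0 : 0 ≤ ρ ^ (k - 1) := pow_nonneg hρ0 _
  have hy1 : ρ ^ (k - 1) ≤ 1 := pow_le_one₀ hρ0 hρ1
  rw [pow_add ρ s (k - 1), pow_succ ρ s]
  set x := ρ ^ s
  set y := ρ ^ (k - 1)
  have hd0 : 0 ≤ x * (1 - y) := mul_nonneg hx0 (by linarith)
  have hd1 : x * (1 - y) ≤ 1 := by nlinarith
  have l0 : 0 ≤ loss / M := by positivity
  -- The right-hand side equals `Tot * (1 - x - jθ) + A * (x * (1 - y)) - C * (1 - x * y) + C * jθ`.
  -- A lower bound for `A` and an upper bound for `C` therefore suffice, and `hroot` says that `1 -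
  -- ρ ^ s` does not decrease on average along the ideal walk.
  have e1 : (p * Tot - loss / M * Tot) * (x * (1 - y)) ≤ A * (x * (1 - y)) :=
    mul_le_mul_of_nonneg_right hA' hd0
  have e2 : loss / M * Tot * (x * (1 - y)) ≤ loss / M * Tot :=
    mul_le_of_le_one_right (by positivity) hd1
  have e3 : C * (1 - x * y) ≤ C := mul_le_of_le_one_right hC0 (by nlinarith)
  have e4 : Tot * (x * (p * y + 1 - p)) ≤ Tot * (x * ρ) :=
    mul_le_mul_of_nonneg_left (mul_le_mul_of_nonneg_left hroot hx0) hT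
  have e5 : ((u + loss) / M + loss / M) * Tot ≤ θ * Tot := mul_le_mul_of_nonneg_right hθ' hT
  have e6 : 0 ≤ C * jθ := mul_nonneg hC0 hjθ
  linarith

/-- The lower bound on the survival probability of the exploration. -/
theorem spread_lower {d : V → ℕ} {k H Δ : ℕ} {ρ p θ : ℝ} (hk : 3 ≤ k) (hρ0 : 0 ≤ ρ)
    (hρ1 : ρ ≤ 1) (hM : 0 < ∑ v, d v)
    (hp : p * ((∑ v, d v : ℕ) : ℝ) = k * ((Finset.univ.filter fun v => d v = k).card : ℝ))
    (hroot : p * ρ ^ (k - 1) + 1 - p ≤ ρ) (hΔ : ∀ v, d v ≤ Δ)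
    (hθ : (k * ((k - 1) * H + 1) + 2 * switchLoss ((k - 1) * H) Δ : ℕ) ≤ θ * ((∑ v, d v : ℕ) : ℝ)) :
    ∀ (j s : ℕ) (U : Finset V) (E : Finset (Sym2 V)), (∀ u ∈ U, d u = k) →
      (∀ e ∈ E, ∀ v ∈ e, d v = k → v ∈ U) → (∀ G ∈ degClass d E, (active G U E).card = s) →
      s + E.card = (k - 1) * U.card + 1 → E.card + j = (k - 1) * H → U.card ≤ E.card + 1 →
      (1 - ρ ^ s - j * θ) * ((degClass d E).card : ℝ) ≤
        ((degClass d E).filter fun G => SpreadsTo d k H G U).card := by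
  have hM' : (0 : ℝ) < ((∑ v, d v : ℕ) : ℝ) := by exact_mod_cast hM
  have hθ0 : 0 ≤ θ := by
    by_contra h
    push Not at h
    have h1 : θ * ((∑ v, d v : ℕ) : ℝ) < 0 := mul_neg_of_neg_of_pos h hM'
    have h2 := (Nat.cast_nonneg (α := ℝ) _).trans hθ
    linarith
  intro j
  induction j with
  | zero =>
    intro s U E hU hE hs hsum hj hUE
    rcases Nat.eq_zero_or_pos s with rfl | hspos
    · simp
    -- With `(k - 1) * H` edges revealed and an arc still active, the balance `s + E.card = (k - 1)
    -- * U.card + 1` forces `U` to be large.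
    · have hH : H ≤ U.card := by
        have h1 : (k - 1) * H < (k - 1) * U.card + 1 := by omega
        exact Nat.le_of_mul_le_mul_left (Nat.lt_succ_iff.1 h1) (by omega)
      have : (degClass d E).filter (fun G => SpreadsTo d k H G U) = degClass d E :=
        Finset.filter_true_of_mem fun G _ => spreadsTo_of_le_card hH
      rw [this]
      have := pow_nonneg hρ0 s
      have h0 : (0 : ℝ) ≤ ((degClass d E).card : ℝ) := Nat.cast_nonneg _
      push_cast
      nlinarith
  | succ j ih =>
    intro s U E hU hE hs hsum hj hUE
    rcases s with _ | s
    -- An extinct exploration makes the claimed lower bound nonpositive.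
    · have h0 : (0 : ℝ) ≤ ((degClass d E).card : ℝ) := Nat.cast_nonneg _
      have h1 : (1 - ρ ^ 0 - ((j + 1 : ℕ) : ℝ) * θ) * ((degClass d E).card : ℝ) ≤ 0 := by
        rw [pow_zero]
        exact mul_nonpos_of_nonpos_of_nonneg
          (by have : 0 ≤ ((j + 1 : ℕ) : ℝ) * θ := by positivity
              linarith) h0
      exact h1.trans (Nat.cast_nonneg _)
    set g₁ : ℝ := 1 - ρ ^ (s + (k - 1)) - j * θ with hg₁
    set g₀ : ℝ := 1 - ρ ^ s - j * θ with hg₀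
    have hstep := sum_explore_le d k H (s + 1) U E hs (fun y => if d y = k then g₁ else g₀) (by
      intro a y ha hy hay
      have hins : (insert s(a, y) E).card = E.card + 1 := Finset.card_insert_of_notMem hay
      by_cases hd : d y = k
      · rw [if_pos hd]
        have hex : explore d k U y = insert y U := if_pos hd
        have hc : (explore d k U y).card = U.card + 1 := by
          rw [hex, Finset.card_insert_of_notMem hy]
        refine ih (s + (k - 1)) _ _ ?_ ?_ ?_ ?_ ?_ ?_
        · rw [hex]
          simpa [hd] using hU
        · rw [hex]
          intro e he v hv hdv
          rw [Finset.mem_insert] at he ⊢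
          rcases he with rfl | he
          · rcases Sym2.mem_iff.1 hv with rfl | rfl
            · exact Or.inr ha
            · exact Or.inl rfl
          · exact Or.inr (hE e he v hv hdv)
        · intro G hG
          obtain ⟨hG1, hG2⟩ := (mem_degClass_insert (q := (a, y))).1 hG
          have := card_active_explore_of_eq ha hy hay hE hG2 hd ((mem_degClass.1 hG1).1 y)
          have := hs G hG1
          omega
        · rw [hins, hc, Nat.mul_add]
          omega
        · omega
        · omega
      · rw [if_neg hd]
        have hex : explore d k U y = U := if_neg hd
        refine ih s _ _ ?_ ?_ ?_ ?_ ?_ ?_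
        · rwa [hex]
        · rw [hex]
          intro e he v hv hdv
          rw [Finset.mem_insert] at he
          rcases he with rfl | he
          · rcases Sym2.mem_iff.1 hv with rfl | rfl
            · exact ha
            · exact absurd hdv hd
          · exact hE e he v hv hdv
        · intro G hG
          obtain ⟨hG1, hG2⟩ := (mem_degClass_insert (q := (a, y))).1 hG
          have := card_active_explore_of_ne ha hy hay hG2 hd
          have := hs G hG1
          omega
        · rw [hins, hex]
          omega
        · omega
        · rw [hex]; omega)
    have hL : ∑ v with d v = k, d v = k * (Finset.univ.filter fun v => d v = k).card := by
      rw [Finset.sum_congr rfl (g := fun _ => k) (fun v hv => (Finset.mem_filter.1 hv).2),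
        Finset.sum_const, smul_eq_mul, mul_comm]
    have hUs : ∑ v with v ∈ U, d v = k * U.card := by
      have : (Finset.univ.filter fun v => v ∈ U) = U := by ext; simp
      rw [this, Finset.sum_congr rfl (g := fun _ => k) (fun v hv => hU v hv),
        Finset.sum_const, smul_eq_mul, mul_comm]
    have hA := active_lower hΔ U E (fun v => d v = k)
    have hC := active_upper hΔ U E (fun v => v ∈ U)
    rw [hL] at hA
    rw [hUs] at hC
    have hTot : ∑ G ∈ degClass d E, (active G U E).card = (s + 1) * (degClass d E).card := by
      rw [Finset.sum_congr rfl hs, Finset.sum_const, smul_eq_mul, mul_comm]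
    rw [hTot] at hA hC
    -- At most `(k - 1) * H` edges are ever revealed, so one `θ` bounds the error of every step.
    have hθ2 : (k * U.card + 2 * switchLoss E.card Δ : ℕ) ≤ θ * ((∑ v, d v : ℕ) : ℝ) := by
      refine le_trans ?_ hθ
      have h1 : E.card ≤ (k - 1) * H := by omega
      have h2 : U.card ≤ (k - 1) * H + 1 := by omega
      have h3 : switchLoss E.card Δ ≤ switchLoss ((k - 1) * H) Δ := by
        unfold switchLoss
        omega
      have h4 := Nat.mul_le_mul_left k h2
      exact_mod_cast Nat.add_le_add h4 (Nat.mul_le_mul_left 2 h3)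
    have hw := walk_step (A := ((∑ G ∈ degClass d E,
        ((active G U E).filter fun q => d q.2 = k).card : ℕ) : ℝ))
      (C := ((∑ G ∈ degClass d E, ((active G U E).filter fun q => q.2 ∈ U).card : ℕ) : ℝ))
      (Tot := (((s + 1) * (degClass d E).card : ℕ) : ℝ)) (u := ((k * U.card : ℕ) : ℝ))
      (loss := ((switchLoss E.card Δ : ℕ) : ℝ)) (jθ := j * θ) (s := s) (θ := θ)
      hρ0 hρ1 hM' (Nat.cast_nonneg _) (Nat.cast_nonneg _)
      (by positivity) (Nat.cast_nonneg _) hp hroot (by exact_mod_cast hA) (by exact_mod_cast hC)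
      (by exact_mod_cast hθ2)
    have hsumG : ∑ G ∈ degClass d E, ∑ q ∈ (active G U E).filter (fun q => q.2 ∉ U),
        (if d q.2 = k then g₁ else g₀) =
        (((∑ G ∈ degClass d E, ((active G U E).filter fun q => d q.2 = k).card : ℕ) : ℝ)
          - ((∑ G ∈ degClass d E, ((active G U E).filter fun q => q.2 ∈ U).card : ℕ) : ℝ)) * g₁
        + ((((s + 1) * (degClass d E).card : ℕ) : ℝ)
          - ((∑ G ∈ degClass d E, ((active G U E).filter fun q => d q.2 = k).card : ℕ) : ℝ)) * g₀ := by
      rw [Finset.sum_congr rfl fun G _ => sum_active_filter hU E G g₁ g₀, ← hTot]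
      push_cast
      rw [Finset.sum_add_distrib, ← Finset.sum_mul, ← Finset.sum_mul, Finset.sum_sub_distrib,
        Finset.sum_sub_distrib]
    rw [hsumG] at hstep
    have hfin := hw.trans hstep
    have hs1 : (0 : ℝ) < ((s + 1 : ℕ) : ℝ) := by positivity
    refine le_of_mul_le_mul_left ?_ hs1
    refine le_trans (le_of_eq ?_) hfin
    push_cast
    ring

end exploration

/-! ### The survival constant and the passage from cascades to lost vertices -/

/-- A single `ρ` must serve all `p` with `p * (k - 1) ≥ 1 + η`. With `ρ = 1 - x` the claim is `x ≤ p
* (1 - (1 - x) ^ (k - 1))`. Bernoulli's inequality for `1 + x` bounds `(1 - x) ^ (k - 1)` by `1 / (1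
+ (k - 1) * x)`, and then `(k - 1) * x ≤ η` is enough. -/
theorem exists_survival_root {k : ℕ} (hk : 3 ≤ k) {η : ℝ} (hη : 0 < η) :
    ∃ ρ : ℝ, 0 ≤ ρ ∧ ρ < 1 ∧ ∀ p : ℝ, 1 + η ≤ p * (k - 1) → p * ρ ^ (k - 1) + 1 - p ≤ ρ := by
  obtain ⟨j, rfl⟩ : ∃ j, k = j + 1 := ⟨k - 1, by omega⟩
  have hj : (0 : ℝ) < j := by exact_mod_cast (by omega : 0 < j)
  set x : ℝ := min (1 / 2) (η / j) with hx
  have hx0 : 0 < x := lt_min (by norm_num) (by positivity)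
  have hx1 : x ≤ 1 / 2 := min_le_left _ _
  have hx2 : j * x ≤ η := by
    have : x ≤ η / j := min_le_right _ _
    rwa [le_div_iff₀ hj, mul_comm] at this
  refine ⟨1 - x, by linarith, by linarith, fun p hp => ?_⟩
  have hp' : 1 + η ≤ p * j := by simpa using hp
  have hp0 : 0 < p := by
    by_contra h
    push Not at h
    have := mul_nonpos_of_nonpos_of_nonneg h hj.le
    linarith
  rw [Nat.add_sub_cancel]
  set y := (1 - x) ^ j with hy
  have hy0 : 0 ≤ y := pow_nonneg (by linarith) j
  have h1 : y * (1 + j * x) ≤ 1 := by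
    calc y * (1 + j * x) ≤ (1 - x) ^ j * (1 + x) ^ j :=
          mul_le_mul_of_nonneg_left (one_add_mul_le_pow (by linarith) j) hy0
      _ = ((1 - x) * (1 + x)) ^ j := (mul_pow _ _ _).symm
      _ ≤ 1 := pow_le_one₀ (by nlinarith) (by nlinarith)
  have hpos : 0 < 1 + j * x := by positivity
  have h2 : x * (1 + j * x) ≤ p * (1 - y) * (1 + j * x) := by
    have h3 : p * (j * x) ≤ p * (1 - y) * (1 + j * x) := by
      have : p * (j * x) ≤ p * ((1 - y) * (1 + j * x)) :=
        mul_le_mul_of_nonneg_left (by linarith) hp0.le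
      linarith
    have h4 : (1 + η) * x ≤ p * j * x := mul_le_mul_of_nonneg_right hp' hx0.le
    have h5 : x * (j * x) ≤ x * η := mul_le_mul_of_nonneg_left hx2 hx0.le
    linarith
  have := le_of_mul_le_mul_right h2 hpos
  linarith

section edges

open Classical

/-- The proportion of edges whose deletion destroys at least `h` vertices. -/
def lossFraction {n : ℕ} (k h : ℕ) (G : SimpleGraph (Fin n)) : ℝ :=
  ((G.edgeFinset.filter fun e => h ≤ lostVertices k G e).card : ℝ) / (G.edgeFinset.card : ℝ)

theorem lossFraction_nonneg {n : ℕ} (k h : ℕ) (G : SimpleGraph (Fin n)) :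
    0 ≤ lossFraction k h G := by
  unfold lossFraction; positivity

/-- Each spreading root of degree `k` is the tail of `k` arcs. Deleting any of their edges starts
the cascade there, and an edge is counted at most twice. -/
theorem card_spread_le {n k H : ℕ} (G : SimpleGraph (Fin n)) :
    k * (Finset.univ.filter fun r => G.degree r = k ∧
        SpreadsTo (fun v => G.degree v) k H G {r}).card
      ≤ 2 * (G.edgeFinset.filter fun e => H ≤ lostVertices k G e).card := by
  set R := Finset.univ.filter fun r => G.degree r = k ∧
        SpreadsTo (fun v => G.degree v) k H G {r} with hR
  have h1 : ((arcs G).filter fun q => q.1 ∈ R).card = k * R.card := by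
    rw [card_arcs_filter_fst G (fun v => v ∈ R), Finset.filter_univ_mem,
      Finset.sum_congr rfl (g := fun _ => k), Finset.sum_const, smul_eq_mul, mul_comm]
    intro r hr
    exact (Finset.mem_filter.1 hr).2.1
  rw [← h1]
  refine Finset.card_le_mul_card_image_of_maps_to (f := fun q : Fin n × Fin n => s(q.1, q.2))
    ?_ 2 ?_
  · intro q hq
    obtain ⟨h2, h3⟩ := Finset.mem_filter.1 hq
    obtain ⟨-, h4, h5⟩ := Finset.mem_filter.1 h3
    have h6 : s(q.1, q.2) ∈ G.edgeSet := mem_arcs.1 h2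
    rw [Finset.mem_filter, SimpleGraph.mem_edgeFinset]
    exact ⟨h6, le_lostVertices h4 h6 (Sym2.mem_mk_left _ _) h5⟩
  · intro e _
    induction e with
    | _ x y =>
      refine (Finset.card_le_card (t := {(x, y), (y, x)}) ?_).trans Finset.card_le_two
      rintro ⟨p, q⟩ hq
      have := (Finset.mem_filter.1 hq).2
      rw [Sym2.eq_iff] at this
      simpa using this

/-- The exploration starts from a single root of degree `k` with nothing revealed and `k` active
arcs. The factor `p` is the fraction of arcs whose tail is such a root. -/
theorem sum_lossFraction_degClass {n : ℕ} {d : Fin n → ℕ} {k H Δ : ℕ} {ρ p θ : ℝ} (hk : 3 ≤ k)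
    (hρ0 : 0 ≤ ρ) (hρ1 : ρ ≤ 1) (hM : 0 < ∑ v, d v)
    (hp : p * ((∑ v, d v : ℕ) : ℝ) = k * ((Finset.univ.filter fun v => d v = k).card : ℝ))
    (hroot : p * ρ ^ (k - 1) + 1 - p ≤ ρ) (hΔ : ∀ v, d v ≤ Δ)
    (hθ : (k * ((k - 1) * H + 1) + 2 * switchLoss ((k - 1) * H) Δ : ℕ) ≤ θ * ((∑ v, d v : ℕ) : ℝ)) :
    p * (1 - ρ ^ k - ((k - 1) * H : ℕ) * θ) * ((degClass d ∅).card : ℝ)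
      ≤ ∑ G ∈ degClass d ∅, lossFraction k H G := by
  have hM' : (0 : ℝ) < ((∑ v, d v : ℕ) : ℝ) := by exact_mod_cast hM
  set L := Finset.univ.filter fun v => d v = k with hL
  have hr : ∀ r ∈ L, (1 - ρ ^ k - ((k - 1) * H : ℕ) * θ) * ((degClass d ∅).card : ℝ) ≤
      ((degClass d ∅).filter fun G => SpreadsTo d k H G {r}).card := by
    intro r hr
    have hrk : d r = k := (Finset.mem_filter.1 hr).2
    refine spread_lower hk hρ0 hρ1 hM hp hroot hΔ hθ ((k - 1) * H) k {r} ∅ ?_ ?_ ?_ ?_ ?_ ?_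
    · simpa using hrk
    · simp
    · intro G hG
      have h1 : active G {r} ∅ = (arcs G).filter fun q => q.1 = r := by
        ext q
        simp [mem_active, mem_arcs, and_comm]
      rw [h1, card_arcs_filter_fst G (fun v => v = r)]
      simp [Finset.filter_eq', (mem_degClass.1 hG).1 r, hrk]
    · simp; omega
    · simp
    · simp
  have hsum := Finset.sum_le_sum hr
  rw [Finset.sum_const, nsmul_eq_mul] at hsum
  have hswap : ∑ r ∈ L, (((degClass d ∅).filter fun G => SpreadsTo d k H G {r}).card : ℝ)
      = ∑ G ∈ degClass d ∅, ((L.filter fun r => SpreadsTo d k H G {r}).card : ℝ) := by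
    simp only [Finset.card_filter, Nat.cast_sum]
    exact Finset.sum_comm
  rw [hswap] at hsum
  have hfrac : ∀ G ∈ degClass d ∅, k * ((L.filter fun r => SpreadsTo d k H G {r}).card : ℝ)
      / ((∑ v, d v : ℕ) : ℝ) ≤ lossFraction k H G := by
    intro G hG
    have hdeg : (fun v => G.degree v) = d := funext (mem_degClass.1 hG).1
    have h1 := card_spread_le (k := k) (H := H) G
    have h2 : (Finset.univ.filter fun r => G.degree r = k ∧
        SpreadsTo (fun v => G.degree v) k H G {r}) = L.filter fun r => SpreadsTo d k H G {r} := by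
      rw [hdeg]
      ext r
      rw [Finset.mem_filter, Finset.mem_filter, hL, Finset.mem_filter, (mem_degClass.1 hG).1 r]
      tauto
    rw [h2] at h1
    have h3 : ∑ v, d v = 2 * G.edgeFinset.card := by
      rw [← G.sum_degrees_eq_twice_card_edges]
      exact Finset.sum_congr rfl fun v _ => ((mem_degClass.1 hG).1 v).symm
    have hE : (0 : ℝ) < G.edgeFinset.card := by
      exact_mod_cast (by omega : 0 < G.edgeFinset.card)
    rw [lossFraction, h3, div_le_div_iff₀ (by push_cast; positivity) hE]
    have h1' : (k : ℝ) * ((L.filter fun r => SpreadsTo d k H G {r}).card : ℝ)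
        ≤ 2 * ((G.edgeFinset.filter fun e => H ≤ lostVertices k G e).card : ℝ) := by
      exact_mod_cast h1
    push_cast
    nlinarith
  refine le_trans ?_ (Finset.sum_le_sum hfrac)
  rw [← Finset.sum_div, ← Finset.mul_sum, le_div_iff₀ hM']
  have hk0 : (0 : ℝ) ≤ k := Nat.cast_nonneg _
  have := mul_le_mul_of_nonneg_left hsum hk0
  calc _ = (p * ((∑ v, d v : ℕ) : ℝ)) * ((1 - ρ ^ k - ((k - 1) * H : ℕ) * θ)
        * ((degClass d ∅).card : ℝ)) := by ring
    _ = k * (L.card * ((1 - ρ ^ k - ((k - 1) * H : ℕ) * θ) * ((degClass d ∅).card : ℝ))) := by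
        rw [hp]; ring
    _ ≤ _ := this

/-- The simple cores with all degrees at most `B` and a supercritical number of vertices of
degree `k`. -/
def goodCores (k n m B : ℕ) (η : ℝ) : Finset (SimpleGraph (Fin n)) :=
  (simpleCores k n m).filter fun G => (∀ v, G.degree v ≤ B) ∧
    (1 + η) * (2 * m : ℝ) ≤
      k * (k - 1) * ((Finset.univ.filter fun v => G.degree v = k).card : ℝ)

theorem mem_simpleCores {k n m : ℕ} {G : SimpleGraph (Fin n)} :
    G ∈ simpleCores k n m ↔ ∑ v, G.degree v = 2 * m ∧ ∀ v, k ≤ G.degree v := by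
  rw [simpleCores, Finset.mem_filter, G.sum_degrees_eq_twice_card_edges]
  have : G.edgeFinset.card = m ↔ 2 * G.edgeFinset.card = 2 * m := by omega
  rw [← this]
  simp

/-- Goodness depends only on the degree sequence, so the good cores are a union of full degree
classes and the bound for one class can be summed. The constant comes from `p ≥ 1 / (k - 1)` and
from giving half of `1 - ρ ^ k` to the error. -/
theorem sum_lossFraction_goodCores {k n m B H : ℕ} {η ρ θ : ℝ} (hk : 3 ≤ k) (hη : 0 ≤ η)
    (hρ0 : 0 ≤ ρ) (hρ1 : ρ ≤ 1) (hm : 0 < m)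
    (hroot : ∀ p : ℝ, 1 + η ≤ p * (k - 1) → p * ρ ^ (k - 1) + 1 - p ≤ ρ)
    (hθ : (k * ((k - 1) * H + 1) + 2 * switchLoss ((k - 1) * H) B : ℕ) ≤ θ * (2 * m : ℝ))
    (hθH : ((k - 1) * H : ℕ) * θ ≤ (1 - ρ ^ k) / 2) :
    (1 - ρ ^ k) / (2 * (k - 1)) * ((goodCores k n m B η).card : ℝ)
      ≤ ∑ G ∈ goodCores k n m B η, lossFraction k H G := by
  have hk1 : (0 : ℝ) < k - 1 := by
    have : (3 : ℝ) ≤ k := by exact_mod_cast hk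
    linarith
  set f : SimpleGraph (Fin n) → (Fin n → ℕ) := fun G v => G.degree v with hf
  set D := (goodCores k n m B η).image f with hD
  have hmaps : ∀ G ∈ goodCores k n m B η, f G ∈ D := fun G hG => Finset.mem_image_of_mem f hG
  have hfib : ∀ d ∈ D, (goodCores k n m B η).filter (fun G => f G = d) = degClass d ∅ := by
    intro d hd
    obtain ⟨G₀, hG₀, rfl⟩ := Finset.mem_image.1 hd
    ext G
    rw [Finset.mem_filter, mem_degClass]
    constructor
    · rintro ⟨-, h⟩
      exact ⟨fun v => congrFun h v, by simp⟩
    · rintro ⟨h, -⟩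
      refine ⟨?_, funext h⟩
      rw [goodCores, Finset.mem_filter, mem_simpleCores] at hG₀ ⊢
      simpa only [h] using hG₀
  rw [← Finset.sum_fiberwise_of_maps_to hmaps, Finset.card_eq_sum_card_fiberwise hmaps,
    Nat.cast_sum, Finset.mul_sum]
  refine Finset.sum_le_sum fun d hd => ?_
  rw [hfib d hd]
  obtain ⟨G₀, hG₀, rfl⟩ := Finset.mem_image.1 hd
  rw [goodCores, Finset.mem_filter, mem_simpleCores] at hG₀
  obtain ⟨⟨hsum, -⟩, hB, hgood⟩ := hG₀
  have hsum' : ∑ v, f G₀ v = 2 * m := hsum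
  have hm' : (0 : ℝ) < 2 * m := by
    have : (0 : ℝ) < m := by exact_mod_cast hm
    linarith
  set p : ℝ := k * ((Finset.univ.filter fun v => f G₀ v = k).card : ℝ) / (2 * m) with hp
  have hpM : p * ((∑ v, f G₀ v : ℕ) : ℝ)
      = k * ((Finset.univ.filter fun v => f G₀ v = k).card : ℝ) := by
    rw [hsum', hp]
    push_cast
    field_simp
  have hp1 : 1 + η ≤ p * (k - 1) := by
    rw [hp, div_mul_eq_mul_div, le_div_iff₀ hm']
    refine hgood.trans (le_of_eq ?_)
    ring
  have hmain := sum_lossFraction_degClass (d := f G₀) (H := H) (θ := θ) hk hρ0 hρ1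
    (by rw [hsum']; omega) hpM (hroot p hp1) hB (by rw [hsum']; push_cast at hθ ⊢; exact hθ)
  refine le_trans (mul_le_mul_of_nonneg_right ?_ (Nat.cast_nonneg _)) hmain
  have hρk : ρ ^ k ≤ 1 := pow_le_one₀ hρ0 hρ1
  have hp2 : 1 / (k - 1) ≤ p := by
    rw [div_le_iff₀ hk1]; linarith
  calc (1 - ρ ^ k) / (2 * (k - 1)) = 1 / (k - 1) * ((1 - ρ ^ k) / 2) := by field_simp
    _ ≤ p * ((1 - ρ ^ k) / 2) := mul_le_mul_of_nonneg_right hp2 (by linarith)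
    _ ≤ p * (1 - ρ ^ k - ((k - 1) * H : ℕ) * θ) :=
        mul_le_mul_of_nonneg_left (by linarith) ((by positivity : (0 : ℝ) ≤ 1 / (k - 1)).trans hp2)

/-- If at least half of the cores are good, then the loss probability is bounded below. -/
theorem le_probLost {k n m B H : ℕ} {η ρ θ : ℝ} (hk : 3 ≤ k) (hη : 0 ≤ η)
    (hρ0 : 0 ≤ ρ) (hρ1 : ρ ≤ 1) (hm : 0 < m)
    (hroot : ∀ p : ℝ, 1 + η ≤ p * (k - 1) → p * ρ ^ (k - 1) + 1 - p ≤ ρ)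
    (hθ : (k * ((k - 1) * H + 1) + 2 * switchLoss ((k - 1) * H) B : ℕ) ≤ θ * (2 * m : ℝ))
    (hθH : ((k - 1) * H : ℕ) * θ ≤ (1 - ρ ^ k) / 2) (hne : (simpleCores k n m).Nonempty)
    (hgood : ((simpleCores k n m).card : ℝ) / 2 ≤ (goodCores k n m B η).card) :
    (1 - ρ ^ k) / (4 * (k - 1)) ≤ probLost k n m H := by
  have hk1 : (0 : ℝ) < k - 1 := by
    have : (3 : ℝ) ≤ k := by exact_mod_cast hk
    linarith
  have hρk : ρ ^ k ≤ 1 := pow_le_one₀ hρ0 hρ1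
  have hpos : (0 : ℝ) < (simpleCores k n m).card := by exact_mod_cast hne.card_pos
  have h1 := sum_lossFraction_goodCores (n := n) hk hη hρ0 hρ1 hm hroot hθ hθH
  have h2 : ∑ G ∈ goodCores k n m B η, lossFraction k H G
      ≤ ∑ G ∈ simpleCores k n m, lossFraction k H G :=
    Finset.sum_le_sum_of_subset_of_nonneg (Finset.filter_subset _ _)
      fun G _ _ => lossFraction_nonneg k H G
  have h3 : probLost k n m H
      = (∑ G ∈ simpleCores k n m, lossFraction k H G) / ((simpleCores k n m).card : ℝ) := rfl
  rw [h3, le_div_iff₀ hpos]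
  refine le_trans ?_ (h1.trans h2)
  calc (1 - ρ ^ k) / (4 * (k - 1)) * ((simpleCores k n m).card : ℝ)
      = (1 - ρ ^ k) / (2 * (k - 1)) * (((simpleCores k n m).card : ℝ) / 2) := by
        field_simp; norm_num
    _ ≤ _ := mul_le_mul_of_nonneg_left hgood (div_nonneg (by linarith) (by linarith))

end edges

/-! ### Rotations and the degree distribution -/

section rotation

open Classical

variable {n : ℕ}

/-- The triples `(u, v, w)` such that `uv` can be replaced by `uw` within the simple `k`-cores. -/
def rotations (k : ℕ) (G : SimpleGraph (Fin n)) : Finset (Fin n × Fin n × Fin n) :=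
  Finset.univ.filter fun t => Rotatable G t.1 t.2.1 t.2.2 ∧ k + 1 ≤ G.degree t.2.1

theorem mem_rotations {k : ℕ} {G : SimpleGraph (Fin n)} {t : Fin n × Fin n × Fin n} :
    t ∈ rotations k G ↔ Rotatable G t.1 t.2.1 t.2.2 ∧ k + 1 ≤ G.degree t.2.1 := by
  simp [rotations]

/-- The result of a rotation. -/
def rotate (G : SimpleGraph (Fin n)) (t : Fin n × Fin n × Fin n) : SimpleGraph (Fin n) :=
  toggle G (rotatePairs t.1 t.2.1 t.2.2)

theorem Rotatable.ne {V : Type*} {G : SimpleGraph V} {u v w : V} (h : Rotatable G u v w) :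
    v ≠ w := fun e => h.2.2 (e ▸ h.1)

theorem degree_rotate {G : SimpleGraph (Fin n)} {t : Fin n × Fin n × Fin n}
    (h : Rotatable G t.1 t.2.1 t.2.2) (x : Fin n) :
    (rotate G t).degree x + (if x = t.2.1 then 1 else 0)
      = G.degree x + (if x = t.2.2 then 1 else 0) := h.degree_toggle x

theorem rotate_mem {k m : ℕ} {G : SimpleGraph (Fin n)} {t : Fin n × Fin n × Fin n}
    (hG : G ∈ simpleCores k n m) (ht : t ∈ rotations k G) : rotate G t ∈ simpleCores k n m := by
  rw [mem_simpleCores] at hG ⊢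
  obtain ⟨h1, h2⟩ := mem_rotations.1 ht
  have hd := degree_rotate h1
  constructor
  · have := Finset.sum_congr (rfl : (Finset.univ : Finset (Fin n)) = Finset.univ)
      fun x _ => hd x
    rw [Finset.sum_add_distrib, Finset.sum_add_distrib, Finset.sum_ite_eq', Finset.sum_ite_eq'] at this
    simp only [Finset.mem_univ, if_true] at this
    omega
  · intro x
    have h3 := hd x
    have h4 := hG.2 x
    by_cases hx : x = t.2.1
    · rw [← hx] at h2
      rw [if_pos hx] at h3
      omega
    · rw [if_neg hx] at h3
      omega

/-- The receiving vertex had degree at least `k`, so after the rotation it has degree at least `k +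
1` and may give the edge back. -/
theorem swap_mem_rotations {k : ℕ} {G : SimpleGraph (Fin n)} (hk : ∀ v, k ≤ G.degree v)
    {t : Fin n × Fin n × Fin n} (ht : t ∈ rotations k G) :
    (t.1, t.2.2, t.2.1) ∈ rotations k (rotate G t) := by
  obtain ⟨h1, h2⟩ := mem_rotations.1 ht
  refine mem_rotations.2 ⟨h1.toggle, ?_⟩
  have := degree_rotate h1 t.2.2
  rw [if_neg h1.ne.symm, if_pos rfl] at this
  have := hk t.2.2
  simp only
  omega

/-- Rotations are reversible. -/
theorem sum_rotations_comm (k m : ℕ) (F : SimpleGraph (Fin n) → Fin n → Fin n → Fin n → ℝ) :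
    ∑ G ∈ simpleCores k n m, ∑ t ∈ rotations k G, F G t.1 t.2.1 t.2.2
      = ∑ G ∈ simpleCores k n m, ∑ t ∈ rotations k G, F (rotate G t) t.1 t.2.2 t.2.1 := by
  rw [Finset.sum_sigma', Finset.sum_sigma']
  let f : (Σ _ : SimpleGraph (Fin n), Fin n × Fin n × Fin n) →
      (Σ _ : SimpleGraph (Fin n), Fin n × Fin n × Fin n) :=
    fun x => ⟨rotate x.1 x.2, (x.2.1, x.2.2.2, x.2.2.1)⟩
  have hf : ∀ x, f (f x) = x := by
    rintro ⟨G, ⟨u, v, w⟩⟩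
    simp only [f, rotate]
    rw [rotatePairs_comm, toggle_toggle]
  have hm : ∀ x ∈ (simpleCores k n m).sigma fun G => rotations k G,
      f x ∈ (simpleCores k n m).sigma fun G => rotations k G := by
    intro x hx
    obtain ⟨h1, h2⟩ := Finset.mem_sigma.1 hx
    exact Finset.mem_sigma.2 ⟨rotate_mem h1 h2, swap_mem_rotations (mem_simpleCores.1 h1).2 h2⟩
  refine Finset.sum_nbij' f f hm hm (fun x _ => hf x) (fun x _ => hf x) ?_
  rintro ⟨G, ⟨u, v, w⟩⟩ _
  simp only [f, rotate]
  rw [rotatePairs_comm, toggle_toggle]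

/-- The number of rotations of prescribed kind. -/
def rotCount (k : ℕ) (G : SimpleGraph (Fin n)) (P R : Fin n → Prop)
    [DecidablePred P] [DecidablePred R] : ℕ :=
  ((rotations k G).filter fun t => P t.2.1 ∧ R t.2.2).card

theorem rotCount_le {k : ℕ} {G : SimpleGraph (Fin n)} (P R : Fin n → Prop)
    [DecidablePred P] [DecidablePred R] :
    rotCount k G P R ≤ (∑ v with P v, G.degree v) * (Finset.univ.filter R).card := by
  rw [← card_arcs_filter_snd, ← Finset.card_product, rotCount]
  refine Finset.card_le_card_of_injOn (fun t => ((t.1, t.2.1), t.2.2)) ?_ ?_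
  · intro t ht
    obtain ⟨h1, h2, h3⟩ := Finset.mem_filter.1 ht
    simp only [Finset.coe_product, Set.mem_prod, Finset.mem_coe, Finset.mem_filter,
      Finset.mem_univ, true_and, mem_arcs]
    exact ⟨⟨(mem_rotations.1 h1).1.1, h2⟩, h3⟩
  · rintro ⟨u, v, w⟩ _ ⟨u', v', w'⟩ _ h
    simpa [and_assoc] using h

/-- For an arc with tail `u`, the only forbidden new heads are `u` and its neighbours, which costs
`deg u + 1` per arc. -/
theorem le_rotCount {k : ℕ} {G : SimpleGraph (Fin n)} {P : Fin n → Prop} (R : Fin n → Prop)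
    [DecidablePred P] [DecidablePred R]
    (hP : ∀ v, P v → k + 1 ≤ G.degree v) :
    (∑ v with P v, G.degree v) * (Finset.univ.filter R).card ≤ rotCount k G P R +
      ∑ q ∈ (arcs G).filter (fun q => P q.2), (G.degree q.1 + 1) := by
  rw [← card_arcs_filter_snd, rotCount]
  have h1 : ((rotations k G).filter fun t => P t.2.1 ∧ R t.2.2).card =
      ∑ q ∈ (arcs G).filter (fun q => P q.2),
        (Finset.univ.filter fun w => R w ∧ q.1 ≠ w ∧ ¬ G.Adj q.1 w).card := by
    rw [← Finset.card_sigma]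
    refine Finset.card_nbij' (fun t => ⟨(t.1, t.2.1), t.2.2⟩) (fun x => (x.1.1, x.1.2, x.2))
      ?_ ?_ (fun _ _ => rfl) (fun _ _ => rfl)
    · intro t ht
      simp only [Finset.coe_filter, Set.mem_ofPred_eq, mem_rotations, Rotatable] at ht
      simp only [Finset.coe_sigma, Set.mem_sigma_iff, Finset.mem_coe, Finset.mem_filter,
        Finset.mem_univ, true_and, mem_arcs]
      tauto
    · intro x hx
      simp only [Finset.coe_sigma, Set.mem_sigma_iff, Finset.mem_coe, Finset.mem_filter,
        Finset.mem_univ, true_and, mem_arcs] at hx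
      simp only [Finset.coe_filter, Set.mem_ofPred_eq, mem_rotations, Rotatable]
      have := hP x.1.2
      tauto
  rw [h1, ← Finset.sum_add_distrib, ← smul_eq_mul]
  refine Finset.card_nsmul_le_sum _ _ _ fun q _ => ?_
  have hsub : Finset.univ.filter R ⊆
      (Finset.univ.filter fun w => R w ∧ q.1 ≠ w ∧ ¬ G.Adj q.1 w) ∪
        insert q.1 (G.neighborFinset q.1) := by
    intro w hw
    simp only [Finset.mem_filter, Finset.mem_univ, true_and, Finset.mem_union, Finset.mem_insert,
      SimpleGraph.mem_neighborFinset] at hw ⊢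
    have : q.1 = w ↔ w = q.1 := eq_comm
    tauto
  refine (Finset.card_le_card hsub).trans ((Finset.card_union_le _ _).trans ?_)
  refine Nat.add_le_add_left ((Finset.card_insert_le _ _).trans ?_) _
  rw [SimpleGraph.card_neighborFinset_eq_degree]

/-! #### The maximum degree -/

/-- The number of simple cores in which `x` has degree `D`. -/
def degCount (k m : ℕ) (x : Fin n) (D : ℕ) : ℕ :=
  ((simpleCores k n m).filter fun G => G.degree x = D).card

/-- Rotations lowering the degree of `x` from `D + 1` to `D` are the reverses of rotations raising
it. A graph admits at least `(D + 1) * n - (2 * m + n)` of the former and at most `2 * m` of the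
latter. -/
theorem degCount_succ_mul_le (k m : ℕ) (x : Fin n) {D : ℕ} (hD : k ≤ D) :
    degCount k m x (D + 1) * ((D + 1) * n)
      ≤ degCount k m x D * (2 * m) + degCount k m x (D + 1) * (2 * m + n) := by
  have key := sum_rotations_comm (n := n) k m
    fun G _ v _ => if v = x ∧ G.degree x = D + 1 then (1 : ℝ) else 0
  have e1 : ∀ G ∈ simpleCores k n m, ∑ t ∈ rotations k G,
      (if t.2.1 = x ∧ G.degree x = D + 1 then (1 : ℝ) else 0)
      = if G.degree x = D + 1 then (rotCount k G (fun v => v = x) (fun _ => True) : ℝ) else 0 := by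
    intro G _
    by_cases h : G.degree x = D + 1
    · simp [h, rotCount, Finset.sum_boole]
    · simp [h]
  have e2 : ∀ G ∈ simpleCores k n m, ∑ t ∈ rotations k G,
      (if t.2.2 = x ∧ (rotate G t).degree x = D + 1 then (1 : ℝ) else 0)
      ≤ if G.degree x = D then ((2 * m : ℕ) : ℝ) else 0 := by
    intro G hG
    have h1 : ∀ t ∈ rotations k G, (t.2.2 = x ∧ (rotate G t).degree x = D + 1) ↔
        (t.2.2 = x ∧ G.degree x = D) := by
      intro t ht
      have h2 := (mem_rotations.1 ht).1
      have h3 := degree_rotate h2 x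
      refine and_congr_right fun hx => ?_
      have h4 : x ≠ t.2.1 := fun h => h2.ne (h ▸ hx.symm)
      rw [if_neg h4, if_pos hx.symm] at h3
      omega
    rw [Finset.sum_congr rfl fun t ht => by rw [if_congr (h1 t ht) rfl rfl]]
    by_cases h : G.degree x = D
    · simp only [h, and_true, if_true]
      rw [Finset.sum_boole]
      have h5 := rotCount_le (k := k) (G := G) (fun _ => True) (fun w => w = x)
      simp only [rotCount, true_and, Finset.filter_true, (mem_simpleCores.1 hG).1,
        Finset.filter_eq', Finset.mem_univ, if_true, Finset.card_singleton, mul_one] at h5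
      exact_mod_cast h5
    · simp [h]
  rw [Finset.sum_congr rfl e1] at key
  have h1 := key.le.trans (Finset.sum_le_sum e2)
  rw [← Finset.sum_filter, ← Finset.sum_filter, Finset.sum_const, nsmul_eq_mul] at h1
  have h2 : ∀ G ∈ (simpleCores k n m).filter (fun G => G.degree x = D + 1),
      (D + 1) * n ≤ rotCount k G (fun v => v = x) (fun _ => True) + (2 * m + n) := by
    intro G hG
    obtain ⟨hG, hx⟩ := Finset.mem_filter.1 hG
    have h3 := le_rotCount (k := k) (G := G) (P := fun v => v = x) (fun _ => True)
      (by rintro v rfl; omega)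
    simp only [Finset.filter_eq', Finset.mem_univ, if_true, Finset.sum_singleton, hx,
      Finset.filter_true, Finset.card_univ, Fintype.card_fin] at h3
    refine h3.trans (Nat.add_le_add_left ?_ _)
    -- Arcs into `x` have distinct tails, so their cost is at most a sum over all vertices.
    have h4 : ∑ q ∈ (arcs G).filter (fun q => q.2 = x), (G.degree q.1 + 1)
        ≤ ∑ v : Fin n, (G.degree v + 1) := by
      refine (Finset.sum_image (s := (arcs G).filter (fun q => q.2 = x)) (g := Prod.fst)
        (f := fun v => G.degree v + 1) ?_).symm.le.trans
        (Finset.sum_le_sum_of_subset (Finset.subset_univ _))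
      rintro ⟨a, b⟩ ha ⟨a', b'⟩ ha' h
      have hb : b = x := (Finset.mem_filter.1 ha).2
      have hb' : b' = x := (Finset.mem_filter.1 ha').2
      simp only at h
      rw [hb, hb', h]
    refine h4.trans ?_
    rw [Finset.sum_add_distrib, (mem_simpleCores.1 hG).1]
    simp
  have h5 := Finset.sum_le_sum h2
  rw [Finset.sum_const, Finset.sum_add_distrib, Finset.sum_const, smul_eq_mul, smul_eq_mul] at h5
  have h6 : ∑ G ∈ (simpleCores k n m).filter (fun G => G.degree x = D + 1),
      rotCount k G (fun v => v = x) (fun _ => True) ≤ degCount k m x D * (2 * m) := by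
    unfold degCount
    exact_mod_cast h1
  exact h5.trans (Nat.add_le_add_right h6 _)

/-- Once `D * n ≥ 6 * m`, the recursion leaves at least `4 * m` on the left against `2 * m` on the
right, so each further degree is at most half as likely. -/
theorem degCount_mul_pow_le {k m : ℕ} (x : Fin n) {D₀ : ℕ} (hk : k ≤ D₀) (hm : 0 < m)
    (hD : 6 * m ≤ D₀ * n) (j : ℕ) :
    degCount k m x (D₀ + j) * 2 ^ j ≤ (simpleCores k n m).card := by
  induction j with
  | zero =>
    rw [pow_zero, mul_one]
    exact Finset.card_filter_le _ _
  | succ j ih =>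
    refine le_trans ?_ ih
    have h1 := degCount_succ_mul_le k m x (D := D₀ + j) (by omega)
    set p := degCount k m x (D₀ + j)
    set q := degCount k m x (D₀ + j + 1)
    have h2 : q * (D₀ * n) ≤ q * ((D₀ + j) * n) :=
      Nat.mul_le_mul_left _ (Nat.mul_le_mul_right _ (by omega))
    have h3 : q * (6 * m) ≤ q * (D₀ * n) := Nat.mul_le_mul_left _ hD
    have h4 : q * 2 * (2 * m) ≤ p * (2 * m) := by
      have : q * ((D₀ + j + 1) * n) = q * ((D₀ + j) * n) + q * n := by ring
      nlinarith
    have h5 : q * 2 ≤ p := Nat.le_of_mul_le_mul_right h4 (by omega)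
    calc q * 2 ^ (j + 1) = q * 2 * 2 ^ j := by ring
      _ ≤ p * 2 ^ j := Nat.mul_le_mul_right _ h5

/-- Few cores have a vertex of degree larger than `D₀ + 3 log₂ n`. -/
theorem card_large_degree_le {k m : ℕ} {D₀ : ℕ} (hk : k ≤ D₀) (hm : 0 < m)
    (hD : 6 * m ≤ D₀ * n) :
    n * ((simpleCores k n m).filter fun G => ¬ ∀ v, G.degree v ≤ D₀ + 3 * Nat.clog 2 n).card
      ≤ (simpleCores k n m).card := by
  rcases Nat.eq_zero_or_pos n with rfl | hn
  · simp
  set B := D₀ + 3 * Nat.clog 2 n with hB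
  have hsub : ((simpleCores k n m).filter fun G => ¬ ∀ v, G.degree v ≤ B) ⊆
      (Finset.univ : Finset (Fin n)).biUnion fun x => (Finset.range n).biUnion fun i =>
        (simpleCores k n m).filter fun G => G.degree x = B + i := by
    intro G hG
    obtain ⟨h1, h2⟩ := Finset.mem_filter.1 hG
    push Not at h2
    obtain ⟨x, hx⟩ := h2
    have hlt : G.degree x < n := by simpa using G.degree_lt_card_verts x
    simp only [Finset.mem_biUnion, Finset.mem_univ, true_and, Finset.mem_range, Finset.mem_filter]
    exact ⟨x, G.degree x - B, by omega, h1, by omega⟩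
  have h1 : ((simpleCores k n m).filter fun G => ¬ ∀ v, G.degree v ≤ B).card ≤
      ∑ x : Fin n, ∑ i ∈ Finset.range n, degCount k m x (B + i) :=
    (Finset.card_le_card hsub).trans (Finset.card_biUnion_le.trans
      (Finset.sum_le_sum fun x _ => Finset.card_biUnion_le))
  -- The factor 3 beats the union bound over `n` vertices and `n` possible degrees by one more power
  -- of `n`.
  have hpow : n ^ 3 ≤ 2 ^ (3 * Nat.clog 2 n) := by
    rw [mul_comm, pow_mul]
    exact Nat.pow_le_pow_left (Nat.le_pow_clog (by norm_num) n) 3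
  have h2 : ∀ (x : Fin n) (i : ℕ), n ^ 3 * degCount k m x (B + i) ≤ (simpleCores k n m).card := by
    intro x i
    have := degCount_mul_pow_le x hk hm hD (3 * Nat.clog 2 n + i)
    rw [← add_assoc, ← hB] at this
    refine le_trans ?_ this
    rw [mul_comm]
    refine Nat.mul_le_mul_left _ (hpow.trans (Nat.pow_le_pow_right (by norm_num) (by omega)))
  have h3 : n ^ 3 * ∑ x : Fin n, ∑ i ∈ Finset.range n, degCount k m x (B + i)
      ≤ n ^ 2 * (simpleCores k n m).card := by
    rw [Finset.mul_sum]
    refine (Finset.sum_le_card_nsmul _ _ (n * (simpleCores k n m).card) fun x _ => ?_).trans ?_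
    · rw [Finset.mul_sum]
      refine (Finset.sum_le_card_nsmul _ _ _ fun i _ => h2 x i).trans ?_
      simp
    · simp only [Finset.card_univ, Fintype.card_fin, smul_eq_mul]
      exact le_of_eq (by ring)
  have h4 := (Nat.mul_le_mul_left (n ^ 3) h1).trans h3
  refine Nat.le_of_mul_le_mul_left (c := n ^ 2) ?_ (by positivity)
  refine le_trans (le_of_eq ?_) h4
  ring

end rotation

/-! ### Second moment of the defect in the degree recursion -/

section moments

open Classical

variable {n : ℕ}

/-- The number of vertices of degree `j`. -/
def degNum (G : SimpleGraph (Fin n)) (j : ℕ) : ℕ :=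
  (Finset.univ.filter fun v => G.degree v = j).card

/-- The defect in the balance equation between the numbers of vertices of degrees `i` and `i + 1`. -/
def defect (k m i : ℕ) (G : SimpleGraph (Fin n)) : ℝ :=
  n * ((i + 1 : ℕ) * degNum G (i + 1)) - (2 * m - k * degNum G k) * degNum G i

/-- The number of pairs of an arc and a vertex that is equal or adjacent to its tail. -/
def rotLoss (G : SimpleGraph (Fin n)) : ℕ := ∑ q ∈ arcs G, (G.degree q.1 + 1)

theorem degNum_le (G : SimpleGraph (Fin n)) (j : ℕ) : degNum G j ≤ n := by
  refine (Finset.card_filter_le _ _).trans ?_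
  simp

theorem sum_degree_eq (G : SimpleGraph (Fin n)) (j : ℕ) :
    ∑ v with G.degree v = j, G.degree v = j * degNum G j := by
  rw [Finset.sum_congr rfl (g := fun _ => j) fun v hv => (Finset.mem_filter.1 hv).2,
    Finset.sum_const, smul_eq_mul, mul_comm, degNum]

theorem sum_degree_gt {k m : ℕ} {G : SimpleGraph (Fin n)} (hG : G ∈ simpleCores k n m) :
    ∑ v with k + 1 ≤ G.degree v, G.degree v + k * degNum G k = 2 * m := by
  rw [mem_simpleCores] at hG
  rw [← sum_degree_eq, ← hG.1,
    ← Finset.sum_filter_add_sum_filter_not Finset.univ (fun v => k + 1 ≤ G.degree v)]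
  congr 1
  refine Finset.sum_congr (Finset.filter_congr fun v _ => ?_) fun _ _ => rfl
  have := hG.2 v
  omega

theorem sum_filter_rotLoss_le (G : SimpleGraph (Fin n)) {α : Type*} (P : α → Prop) [DecidablePred P]
    (f : Fin n × Fin n → α) :
    ∑ q ∈ (arcs G).filter (fun q => P (f q)), (G.degree q.1 + 1) ≤ rotLoss G :=
  Finset.sum_le_sum_of_subset (Finset.filter_subset _ _)

/-- Together with `rotCount_lower` this identifies the two terms of the defect, up to `rotLoss`,
with the numbers of rotations in two mutually inverse families: a vertex of degree `i + 1` gives up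
an edge, or a vertex of degree `i` receives one. -/
theorem rotCount_raise {k i : ℕ} (hi : k ≤ i) (G : SimpleGraph (Fin n)) :
    rotCount k G (fun v => G.degree v = i + 1) (fun _ => True) ≤ n * ((i + 1) * degNum G (i + 1)) ∧
      n * ((i + 1) * degNum G (i + 1)) ≤
        rotCount k G (fun v => G.degree v = i + 1) (fun _ => True) + rotLoss G := by
  have h1 := rotCount_le (k := k) (G := G) (fun v => G.degree v = i + 1) (fun _ => True)
  have h2 := le_rotCount (k := k) (G := G) (P := fun v => G.degree v = i + 1) (fun _ => True)
    (fun v hv => by omega)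
  rw [sum_degree_eq, Finset.filter_true, Finset.card_univ, Fintype.card_fin, mul_comm] at h1 h2
  exact ⟨h1, h2.trans (Nat.add_le_add_left
    (sum_filter_rotLoss_le G (fun v => G.degree v = i + 1) Prod.snd) _)⟩

theorem rotCount_lower {k m i : ℕ} {G : SimpleGraph (Fin n)} (hG : G ∈ simpleCores k n m) :
    (rotCount k G (fun v => k + 1 ≤ G.degree v) (fun w => G.degree w = i) : ℝ)
        ≤ (2 * m - k * degNum G k) * degNum G i ∧
      (2 * m - k * degNum G k : ℝ) * degNum G i ≤
        rotCount k G (fun v => k + 1 ≤ G.degree v) (fun w => G.degree w = i) + rotLoss G := by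
  have h1 := rotCount_le (k := k) (G := G) (fun v => k + 1 ≤ G.degree v) (fun w => G.degree w = i)
  have h2 := le_rotCount (k := k) (G := G) (P := fun v => k + 1 ≤ G.degree v)
    (fun w => G.degree w = i) (fun v hv => hv)
  have h3 := h2.trans (Nat.add_le_add_left
    (sum_filter_rotLoss_le G (fun v => k + 1 ≤ G.degree v) Prod.snd) _)
  have h4 : (2 * m - k * degNum G k : ℝ) = ((∑ v with k + 1 ≤ G.degree v, G.degree v : ℕ) : ℝ) := by
    have h5 : ((∑ v with k + 1 ≤ G.degree v, G.degree v : ℕ) : ℝ) + k * degNum G k = 2 * m := by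
      exact_mod_cast sum_degree_gt hG
    linarith
  rw [h4]
  constructor
  · exact_mod_cast h1
  · exact_mod_cast h3

theorem abs_degNum_rotate_sub_le {G : SimpleGraph (Fin n)} {t : Fin n × Fin n × Fin n}
    (h : Rotatable G t.1 t.2.1 t.2.2) (j : ℕ) :
    |(degNum (rotate G t) j : ℝ) - degNum G j| ≤ 2 := by
  have key : ∀ x, x ∉ ({t.2.1, t.2.2} : Finset (Fin n)) → (rotate G t).degree x = G.degree x := by
    intro x hx
    simp only [Finset.mem_insert, Finset.mem_singleton, not_or] at hx
    have := degree_rotate h x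
    rwa [if_neg hx.1, if_neg hx.2] at this
  have h1 : degNum (rotate G t) j ≤ degNum G j + 2 := by
    unfold degNum
    refine (Finset.card_le_card (t := (Finset.univ.filter fun v => G.degree v = j) ∪
      {t.2.1, t.2.2}) ?_).trans ((Finset.card_union_le _ _).trans
        (Nat.add_le_add_left Finset.card_le_two _))
    intro x hx
    by_cases hx' : x ∈ ({t.2.1, t.2.2} : Finset (Fin n))
    · exact Finset.mem_union_right _ hx'
    · refine Finset.mem_union_left _ ?_
      rw [Finset.mem_filter, key x hx'] at hx
      simpa using hx
  have h2 : degNum G j ≤ degNum (rotate G t) j + 2 := by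
    unfold degNum
    refine (Finset.card_le_card (t := (Finset.univ.filter fun v => (rotate G t).degree v = j) ∪
      {t.2.1, t.2.2}) ?_).trans ((Finset.card_union_le _ _).trans
        (Nat.add_le_add_left Finset.card_le_two _))
    intro x hx
    by_cases hx' : x ∈ ({t.2.1, t.2.2} : Finset (Fin n))
    · exact Finset.mem_union_right _ hx'
    · refine Finset.mem_union_left _ ?_
      rw [Finset.mem_filter, ← key x hx'] at hx
      simpa using hx
  have h1' : (degNum (rotate G t) j : ℝ) ≤ degNum G j + 2 := by exact_mod_cast h1
  have h2' : (degNum G j : ℝ) ≤ degNum (rotate G t) j + 2 := by exact_mod_cast h2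
  rw [abs_le]
  constructor <;> linarith

theorem excess_bounds {k m : ℕ} {G : SimpleGraph (Fin n)} (hG : G ∈ simpleCores k n m) :
    0 ≤ (2 * m - k * degNum G k : ℝ) ∧ (2 * m - k * degNum G k : ℝ) ≤ 2 * m := by
  have h5 : ((∑ v with k + 1 ≤ G.degree v, G.degree v : ℕ) : ℝ) + k * degNum G k = 2 * m := by
    exact_mod_cast sum_degree_gt hG
  have h6 : (0 : ℝ) ≤ ((∑ v with k + 1 ≤ G.degree v, G.degree v : ℕ) : ℝ) := Nat.cast_nonneg _
  have h7 : (0 : ℝ) ≤ k * degNum G k := by positivity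
  constructor <;> linarith

/-- A rotation changes each degree count by at most 2, so the defect moves by O(n) although its
natural scale is n². -/
theorem defect_rotate_sub_le {k m : ℕ} (i : ℕ) {G : SimpleGraph (Fin n)} {t : Fin n × Fin n × Fin n}
    (hG : G ∈ simpleCores k n m) (ht : t ∈ rotations k G) :
    defect k m i (rotate G t) - defect k m i G ≤ 2 * n * (i + 1 : ℕ) + 4 * m + 2 * k * n := by
  have hr := (mem_rotations.1 ht).1
  have d1 := abs_le.1 (abs_degNum_rotate_sub_le hr (i + 1))
  have d2 := abs_le.1 (abs_degNum_rotate_sub_le hr i)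
  have d3 := abs_le.1 (abs_degNum_rotate_sub_le hr k)
  obtain ⟨x0, x1⟩ := excess_bounds (rotate_mem hG ht)
  have hn : (degNum G i : ℝ) ≤ n := by exact_mod_cast degNum_le G i
  have hn0 : (0 : ℝ) ≤ degNum G i := Nat.cast_nonneg _
  have hk0 : (0 : ℝ) ≤ k := Nat.cast_nonneg _
  unfold defect
  set A' : ℝ := (degNum (rotate G t) (i + 1) : ℝ)
  set A : ℝ := (degNum G (i + 1) : ℝ)
  set b' : ℝ := (degNum (rotate G t) i : ℝ)
  set b : ℝ := (degNum G i : ℝ)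
  set c' : ℝ := (degNum (rotate G t) k : ℝ)
  set c : ℝ := (degNum G k : ℝ)
  have e1 : (n * (i + 1 : ℕ) : ℝ) * (A' - A) ≤ (n * (i + 1 : ℕ) : ℝ) * 2 :=
    mul_le_mul_of_nonneg_left d1.2 (by positivity)
  have e2 : (2 * m - k * c') * (b - b') ≤ (2 * m - k * c') * 2 :=
    mul_le_mul_of_nonneg_left (by linarith) x0
  have e3 : k * (b * (c' - c)) ≤ k * (n * 2) := by
    refine mul_le_mul_of_nonneg_left ?_ hk0
    exact (mul_le_mul_of_nonneg_left d3.2 hn0).trans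
      (mul_le_mul_of_nonneg_right hn (by norm_num))
  linarith

theorem abs_defect_le {k m : ℕ} (i : ℕ) {G : SimpleGraph (Fin n)} (hG : G ∈ simpleCores k n m) :
    |defect k m i G| ≤ n * ((i + 1 : ℕ) * n) + 2 * m * n := by
  obtain ⟨x0, x1⟩ := excess_bounds hG
  have hn : (degNum G i : ℝ) ≤ n := by exact_mod_cast degNum_le G i
  have hn' : (degNum G (i + 1) : ℝ) ≤ n := by exact_mod_cast degNum_le G (i + 1)
  have e1 : (n * ((i + 1 : ℕ) * degNum G (i + 1)) : ℝ) ≤ n * ((i + 1 : ℕ) * n) := by gcongr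
  have e0 : (0 : ℝ) ≤ n * ((i + 1 : ℕ) * degNum G (i + 1)) := by positivity
  have e2 : (2 * m - k * degNum G k : ℝ) * degNum G i ≤ 2 * m * n :=
    mul_le_mul x1 hn (Nat.cast_nonneg _) (by positivity)
  have e3 : 0 ≤ (2 * m - k * degNum G k : ℝ) * degNum G i := mul_nonneg x0 (Nat.cast_nonneg _)
  unfold defect
  rw [abs_le]
  constructor <;> linarith

/-- Reversing the rotations counted by the first term turns them into those counted by the second,
with the defect evaluated at the rotated graph. Only the change of the defect under a rotation is
left. -/
theorem sum_rotCount_mul_defect_le (k m : ℕ) {i : ℕ} :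
    ∑ G ∈ simpleCores k n m,
        ((rotCount k G (fun v => G.degree v = i + 1) (fun _ => True) : ℝ)
          - rotCount k G (fun v => k + 1 ≤ G.degree v) (fun w => G.degree w = i)) * defect k m i G
      ≤ ∑ G ∈ simpleCores k n m,
        (rotCount k G (fun v => k + 1 ≤ G.degree v) (fun w => G.degree w = i) : ℝ)
          * (2 * n * (i + 1 : ℕ) + 4 * m + 2 * k * n) := by
  have key := sum_rotations_comm (n := n) k m
    fun G _ v _ => (if G.degree v = i + 1 then (1 : ℝ) else 0) * defect k m i G
  have e1 : ∀ G ∈ simpleCores k n m, ∑ t ∈ rotations k G,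
      (if G.degree t.2.1 = i + 1 then (1 : ℝ) else 0) * defect k m i G
      = (rotCount k G (fun v => G.degree v = i + 1) (fun _ => True) : ℝ) * defect k m i G := by
    intro G _
    rw [← Finset.sum_mul, Finset.sum_boole]
    simp [rotCount]
  have e2 : ∀ G ∈ simpleCores k n m, ∀ t ∈ rotations k G,
      (if (rotate G t).degree t.2.2 = i + 1 then (1 : ℝ) else 0) * defect k m i (rotate G t)
      = (if G.degree t.2.2 = i then (1 : ℝ) else 0) * defect k m i (rotate G t) := by
    intro G _ t ht
    have h1 := (mem_rotations.1 ht).1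
    have h2 := degree_rotate h1 t.2.2
    rw [if_neg h1.ne.symm, if_pos rfl] at h2
    rw [if_congr (show (rotate G t).degree t.2.2 = i + 1 ↔ G.degree t.2.2 = i by omega) rfl rfl]
  have e3 : ∀ G ∈ simpleCores k n m,
      (rotCount k G (fun v => k + 1 ≤ G.degree v) (fun w => G.degree w = i) : ℝ)
      = ∑ t ∈ rotations k G, if G.degree t.2.2 = i then (1 : ℝ) else 0 := by
    intro G _
    rw [Finset.sum_boole, rotCount]
    congr 2
    refine Finset.filter_congr fun t ht => ?_
    simp [(mem_rotations.1 ht).2]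
  simp only [sub_mul]
  rw [Finset.sum_sub_distrib, ← Finset.sum_congr rfl e1, key,
    Finset.sum_congr rfl fun G hG => Finset.sum_congr rfl (e2 G hG), ← Finset.sum_sub_distrib]
  refine Finset.sum_le_sum fun G hG => ?_
  rw [e3 G hG, Finset.sum_mul, Finset.sum_mul, ← Finset.sum_sub_distrib]
  refine Finset.sum_le_sum fun t ht => ?_
  rw [← mul_sub]
  exact mul_le_mul_of_nonneg_left (defect_rotate_sub_le i hG ht) (by split_ifs <;> norm_num)

/-- The defect differs from the difference of the two rotation counts by at most `rotLoss`. Its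
square is thus that difference times the defect, which `sum_rotCount_mul_defect_le` controls, plus
an error of `rotLoss` times the trivial bound on the defect. -/
theorem sum_defect_sq_le (k m : ℕ) {i : ℕ} (hi : k ≤ i) :
    ∑ G ∈ simpleCores k n m, defect k m i G ^ 2
      ≤ ∑ _G ∈ simpleCores k n m, (2 * m * n) * (2 * n * (i + 1 : ℕ) + 4 * m + 2 * k * n : ℝ)
        + ∑ G ∈ simpleCores k n m, (rotLoss G : ℝ) * (n * ((i + 1 : ℕ) * n) + 2 * m * n) := by
  have h1 : ∀ G ∈ simpleCores k n m, defect k m i G ^ 2 ≤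
      ((rotCount k G (fun v => G.degree v = i + 1) (fun _ => True) : ℝ)
          - rotCount k G (fun v => k + 1 ≤ G.degree v) (fun w => G.degree w = i)) * defect k m i G
      + (rotLoss G : ℝ) * (n * ((i + 1 : ℕ) * n) + 2 * m * n) := by
    intro G hG
    obtain ⟨a1, a2⟩ := rotCount_raise hi G
    obtain ⟨b1, b2⟩ := rotCount_lower (i := i) hG
    set p := rotCount k G (fun v => G.degree v = i + 1) (fun _ => True)
    set q := rotCount k G (fun v => k + 1 ≤ G.degree v) (fun w => G.degree w = i)
    have a1' : (p : ℝ) ≤ n * ((i + 1 : ℕ) * degNum G (i + 1)) := by exact_mod_cast a1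
    have a2' : (n * ((i + 1 : ℕ) * degNum G (i + 1)) : ℝ) ≤ p + rotLoss G := by exact_mod_cast a2
    have h2 : |defect k m i G - (p - q)| ≤ rotLoss G := by
      have : defect k m i G = n * ((i + 1 : ℕ) * degNum G (i + 1))
        - (2 * m - k * degNum G k) * degNum G i := rfl
      rw [this, abs_le]
      constructor <;> linarith
    have h3 := mul_le_mul h2 (abs_defect_le i hG) (abs_nonneg _) (Nat.cast_nonneg _)
    rw [← abs_mul] at h3
    have h4 := (le_abs_self _).trans h3
    linarith
  refine (Finset.sum_le_sum h1).trans ?_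
  rw [Finset.sum_add_distrib]
  refine add_le_add ((sum_rotCount_mul_defect_le k m).trans (Finset.sum_le_sum fun G hG => ?_)) le_rfl
  refine mul_le_mul_of_nonneg_right ?_ (by positivity)
  obtain ⟨x0, x1⟩ := excess_bounds hG
  have hn : (degNum G i : ℝ) ≤ n := by exact_mod_cast degNum_le G i
  exact (rotCount_lower (i := i) hG).1.trans
    (mul_le_mul x1 hn (Nat.cast_nonneg _) (by positivity))

theorem rotLoss_le {k m B : ℕ} {G : SimpleGraph (Fin n)} (hG : G ∈ simpleCores k n m)
    (hB : ∀ v, G.degree v ≤ B) : rotLoss G ≤ 2 * m * (B + 1) := by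
  unfold rotLoss
  refine (Finset.sum_le_card_nsmul _ _ (B + 1) fun q _ => Nat.succ_le_succ (hB q.1)).trans ?_
  rw [card_arcs, (mem_simpleCores.1 hG).1, smul_eq_mul]

/-- Graphs with a large degree are at most a fraction `1 / n` of all, which compensates for the
trivial bound `2 * m * n` used on them; this is why 2 appears where a bounded-degree graph needs 1.
-/
theorem sum_rotLoss_le {k m D₀ : ℕ} (hk : k ≤ D₀) (hm : 0 < m) (hD : 6 * m ≤ D₀ * n) :
    ∑ G ∈ simpleCores k n m, rotLoss G
      ≤ 2 * m * (D₀ + 3 * Nat.clog 2 n + 2) * (simpleCores k n m).card := by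
  set B := D₀ + 3 * Nat.clog 2 n with hB
  have h1 : ∀ G ∈ simpleCores k n m,
      rotLoss G ≤ 2 * m * (B + 1) + if ¬ ∀ v, G.degree v ≤ B then 2 * m * n else 0 := by
    intro G hG
    by_cases h : ∀ v, G.degree v ≤ B
    · rw [if_neg (not_not.2 h), add_zero]
      exact rotLoss_le hG h
    · rw [if_pos h]
      rcases Nat.eq_zero_or_pos n with rfl | hn
      · exact absurd (fun v => v.elim0) h
      · have := rotLoss_le (B := n - 1) hG fun v => by
          have : G.degree v < n := by simpa using G.degree_lt_card_verts v
          omega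
        rw [Nat.sub_add_cancel hn] at this
        omega
  refine (Finset.sum_le_sum h1).trans ?_
  rw [Finset.sum_add_distrib, Finset.sum_const, ← Finset.sum_filter, Finset.sum_const, smul_eq_mul,
    smul_eq_mul]
  have h2 := Nat.mul_le_mul_left (2 * m) (card_large_degree_le hk hm hD)
  rw [← hB] at h2
  linarith

/-- Second moment bound for the defect. -/
theorem card_defect_gt_le {k m D₀ C i : ℕ} (hi : k ≤ i) (hk : k ≤ D₀) (hm : 0 < m)
    (hD : 6 * m ≤ D₀ * n) (hC : 2 * m ≤ C * n) {ξ : ℝ} (hξ : 0 < ξ) :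
    (((simpleCores k n m).filter fun G => ¬ |defect k m i G| ≤ ξ * n ^ 2).card : ℝ) * (ξ ^ 2 * n)
      ≤ C * (i + 1 + C + k) * (D₀ + 3 * Nat.clog 2 n + 4) * (simpleCores k n m).card := by
  have hn : 0 < n := by
    rcases Nat.eq_zero_or_pos n with rfl | h
    · omega
    · exact h
  have hn' : (0 : ℝ) < n := by exact_mod_cast hn
  set T := (simpleCores k n m).filter fun G => ¬ |defect k m i G| ≤ ξ * n ^ 2 with hT
  -- Chebyshev's inequality: the second moment is O(n³ log n), against a threshold of order n⁴.
  have h1 : (T.card : ℝ) * (ξ * n ^ 2) ^ 2 ≤ ∑ G ∈ simpleCores k n m, defect k m i G ^ 2 := by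
    rw [← nsmul_eq_mul]
    refine (Finset.card_nsmul_le_sum T (fun G => defect k m i G ^ 2) _ fun G hG => ?_).trans
      (Finset.sum_le_sum_of_subset_of_nonneg (Finset.filter_subset _ _)
        fun G _ _ => sq_nonneg _)
    have := (Finset.mem_filter.1 hG).2
    push Not at this
    rw [← sq_abs (defect k m i G)]
    exact pow_le_pow_left₀ (by positivity) this.le 2
  have h2 := h1.trans (sum_defect_sq_le k m hi)
  have hC' : (2 * m : ℝ) ≤ C * n := by exact_mod_cast hC
  set S : ℝ := ((simpleCores k n m).card : ℝ) with hS
  have hS0 : 0 ≤ S := Nat.cast_nonneg _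
  set b : ℝ := D₀ + 3 * Nat.clog 2 n + 2 with hb
  have hb0 : 0 ≤ b := by positivity
  have h3 : ∑ G ∈ simpleCores k n m, (rotLoss G : ℝ) ≤ 2 * m * b * S := by
    have := sum_rotLoss_le (n := n) hk hm hD
    rw [hb, hS]
    exact_mod_cast this
  rw [Finset.sum_const, nsmul_eq_mul, ← Finset.sum_mul] at h2
  set c : ℝ := i + 1 + C + k with hc
  have hc0 : 0 ≤ c := by positivity
  have hk0 : (0 : ℝ) ≤ k := Nat.cast_nonneg _
  have e1 : (n * ((i + 1 : ℕ) * n) + 2 * m * n : ℝ) ≤ c * n ^ 2 := by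
    have : (2 * m * n : ℝ) ≤ C * n * n := mul_le_mul_of_nonneg_right hC' hn'.le
    have h4 : (0 : ℝ) ≤ k * n ^ 2 := by positivity
    rw [hc]; push_cast
    nlinarith
  have e2 : (2 * n * (i + 1 : ℕ) + 4 * m + 2 * k * n : ℝ) ≤ 2 * c * n := by
    rw [hc]; push_cast
    nlinarith
  have e3 : (2 * m * n : ℝ) * (2 * n * (i + 1 : ℕ) + 4 * m + 2 * k * n : ℝ)
      ≤ (C * n * n) * (2 * c * n) := by gcongr
  have e4 : (2 * m * b * S : ℝ) ≤ C * n * b * S := by gcongr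
  have e5 := mul_le_mul (h3.trans e4) e1 (by positivity) (by positivity)
  have e6 := mul_le_mul_of_nonneg_left e3 hS0
  have h4 : (T.card : ℝ) * (ξ * n ^ 2) ^ 2 ≤ (C * c * (b + 2) * S) * n ^ 3 := by
    refine h2.trans ((add_le_add e6 e5).trans (le_of_eq ?_))
    ring
  have h5 : (T.card : ℝ) * (ξ ^ 2 * n) * n ^ 3 ≤ (C * c * (b + 2) * S) * n ^ 3 := by
    refine le_trans (le_of_eq ?_) h4
    ring
  refine (le_of_mul_le_mul_right h5 (by positivity)).trans (le_of_eq ?_)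
  rw [hb]
  ring

end moments

/-! ### Truncated Poisson distributions -/

theorem tendsto_partial_expTail (k : ℕ) (x : ℝ) :
    Tendsto (fun N => ∑ i ∈ Finset.range N, x ^ (k + i) / ((k + i).factorial : ℝ)) atTop
      (𝓝 (expTail k x)) := by
  have h := (NormedSpace.expSeries_div_hasSum_exp x).tendsto_sum_nat
  rw [← Real.exp_eq_exp_ℝ] at h
  have h1 := ((tendsto_add_atTop_iff_nat k).2 h).sub_const
    (∑ i ∈ Finset.range k, x ^ i / (i.factorial : ℝ))
  refine h1.congr fun N => ?_
  rw [add_comm N k, Finset.sum_range_add]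
  ring

theorem sum_range_le_expTail (k N : ℕ) {x : ℝ} (hx : 0 ≤ x) :
    ∑ i ∈ Finset.range N, x ^ (k + i) / ((k + i).factorial : ℝ) ≤ expTail k x := by
  have := Real.sum_le_exp_of_nonneg hx (k + N)
  rw [Finset.sum_range_add] at this
  unfold expTail
  linarith

/-- The probability that a truncated Poisson variable takes its least value `k`. -/
def truncMass (k : ℕ) (x : ℝ) : ℝ := x ^ k / (k.factorial : ℝ) / expTail k x

/-- The mean of a Poisson variable conditioned to be at least `k`. -/
def truncMean (k : ℕ) (x : ℝ) : ℝ := x * expTail (k - 1) x / expTail k x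

/-- This mirrors the identity c = l + k N_k / n satisfied by the parameter of a core. -/
theorem truncMean_eq {k : ℕ} (hk : 1 ≤ k) {x : ℝ} (hx : 0 < x) :
    truncMean k x = x + k * truncMass k x := by
  obtain ⟨j, rfl⟩ : ∃ j, k = j + 1 := ⟨k - 1, by omega⟩
  have h := (expTail_pos (j + 1) x hx).ne'
  have hj : (j.factorial : ℝ) ≠ 0 := by positivity
  have hj' : ((j : ℝ) + 1) ≠ 0 := by positivity
  rw [truncMean, truncMass, Nat.add_sub_cancel, expTail_eq_add j, Nat.factorial_succ]
  push_cast
  field_simp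
  ring

theorem truncMass_nonneg (k : ℕ) {x : ℝ} (hx : 0 < x) : 0 ≤ truncMass k x := by
  have := expTail_pos k x hx
  unfold truncMass
  positivity

theorem truncMass_le_one (k : ℕ) {x : ℝ} (hx : 0 < x) : truncMass k x ≤ 1 := by
  rw [truncMass, div_le_one (expTail_pos k x hx), expTail_eq_add]
  linarith [expTail_pos (k + 1) x hx]

/-- The mean of the weights `w i * a ^ i` grows with `a`. After symmetrizing in `i` and `j`, the
difference is half a double sum whose terms are nonnegative, since `i - j` and `b ^ i * a ^ j - a ^
i * b ^ j` do not have opposite signs. -/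
theorem sum_mul_sum_le_of_le (w : ℕ → ℝ) (hw : ∀ i, 0 ≤ w i) {a b : ℝ} (ha : 0 ≤ a)
    (hab : a ≤ b) (N : ℕ) :
    (∑ i ∈ Finset.range N, i * (w i * a ^ i)) * ∑ i ∈ Finset.range N, w i * b ^ i
      ≤ (∑ i ∈ Finset.range N, i * (w i * b ^ i)) * ∑ i ∈ Finset.range N, w i * a ^ i := by
  have hsym : 2 * ((∑ i ∈ Finset.range N, i * (w i * b ^ i)) * ∑ i ∈ Finset.range N, w i * a ^ i
      - (∑ i ∈ Finset.range N, i * (w i * a ^ i)) * ∑ i ∈ Finset.range N, w i * b ^ i)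
      = ∑ i ∈ Finset.range N, ∑ j ∈ Finset.range N,
        ((i : ℝ) - j) * (b ^ i * a ^ j - a ^ i * b ^ j) * (w i * w j) := by
    have e1 := Finset.sum_mul_sum (Finset.range N) (Finset.range N)
      (fun i => (i : ℝ) * (w i * b ^ i)) (fun i => w i * a ^ i)
    have e2 := Finset.sum_mul_sum (Finset.range N) (Finset.range N)
      (fun i => (i : ℝ) * (w i * a ^ i)) (fun i => w i * b ^ i)
    have e3 := e1.trans Finset.sum_comm
    have e4 := e2.trans Finset.sum_comm
    rw [two_mul]
    nth_rewrite 1 [e1, e2]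
    rw [e3, e4]
    simp only [← Finset.sum_sub_distrib, ← Finset.sum_add_distrib]
    refine Finset.sum_congr rfl fun i _ => Finset.sum_congr rfl fun j _ => ?_
    ring
  have hnn : 0 ≤ ∑ i ∈ Finset.range N, ∑ j ∈ Finset.range N,
      ((i : ℝ) - j) * (b ^ i * a ^ j - a ^ i * b ^ j) * (w i * w j) := by
    refine Finset.sum_nonneg fun i _ => Finset.sum_nonneg fun j _ =>
      mul_nonneg ?_ (mul_nonneg (hw i) (hw j))
    have key : ∀ i d : ℕ, a ^ (i + d) * b ^ i ≤ b ^ (i + d) * a ^ i := by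
      intro i d
      have h1 : a ^ d ≤ b ^ d := pow_le_pow_left₀ ha hab d
      have h2 : 0 ≤ a ^ i * b ^ i := mul_nonneg (pow_nonneg ha i) (pow_nonneg (ha.trans hab) i)
      calc a ^ (i + d) * b ^ i = a ^ i * b ^ i * a ^ d := by ring
        _ ≤ a ^ i * b ^ i * b ^ d := mul_le_mul_of_nonneg_left h1 h2
        _ = b ^ (i + d) * a ^ i := by ring
    rcases le_total j i with h | h
    · obtain ⟨d, rfl⟩ := Nat.exists_eq_add_of_le h
      refine mul_nonneg (by push_cast; linarith [(Nat.cast_nonneg d : (0 : ℝ) ≤ d)]) ?_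
      linarith [key j d]
    · obtain ⟨d, rfl⟩ := Nat.exists_eq_add_of_le h
      refine mul_nonneg_of_nonpos_of_nonpos
        (by push_cast; linarith [(Nat.cast_nonneg d : (0 : ℝ) ≤ d)]) ?_
      linarith [key i d]
  linarith

/-- The finite inequality for weights `1 / i!` supported on `i ≥ k` passes to the limit. -/
theorem truncMean_mono {k : ℕ} (hk : 1 ≤ k) {a b : ℝ} (ha : 0 < a) (hab : a ≤ b) :
    truncMean k a ≤ truncMean k b := by
  obtain ⟨j, rfl⟩ : ∃ j, k = j + 1 := ⟨k - 1, by omega⟩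
  have hb := ha.trans_le hab
  rw [truncMean, truncMean, div_le_div_iff₀ (expTail_pos _ a ha) (expTail_pos _ b hb),
    Nat.add_sub_cancel]
  set w : ℕ → ℝ := fun i => if j + 1 ≤ i then 1 / (i.factorial : ℝ) else 0 with hw
  have hwn : ∀ i, 0 ≤ w i := fun i => by simp only [hw]; split_ifs <;> positivity
  have hzero : ∀ i ∈ Finset.range (j + 1), w i = 0 := by
    intro i hi
    rw [Finset.mem_range] at hi
    exact if_neg (by omega)
  have hpos : ∀ i, w (j + 1 + i) = 1 / ((j + 1 + i).factorial : ℝ) := fun i => if_pos (by omega)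
  have h1 : ∀ x : ℝ, Tendsto (fun N => ∑ i ∈ Finset.range (j + 1 + N), w i * x ^ i) atTop
      (𝓝 (expTail (j + 1) x)) := by
    intro x
    refine (tendsto_partial_expTail (j + 1) x).congr fun N => ?_
    rw [Finset.sum_range_add,
      Finset.sum_eq_zero (s := Finset.range (j + 1)) (fun i hi => by rw [hzero i hi, zero_mul]),
      zero_add]
    refine Finset.sum_congr rfl fun i _ => ?_
    rw [hpos]
    ring
  have h2 : ∀ x : ℝ, Tendsto (fun N => ∑ i ∈ Finset.range (j + 1 + N), i * (w i * x ^ i)) atTop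
      (𝓝 (x * expTail j x)) := by
    intro x
    refine ((tendsto_partial_expTail j x).const_mul x).congr fun N => ?_
    rw [Finset.sum_range_add,
      Finset.sum_eq_zero (s := Finset.range (j + 1)) (fun i hi => by rw [hzero i hi]; ring),
      zero_add, Finset.mul_sum]
    refine Finset.sum_congr rfl fun i _ => ?_
    rw [hpos, show j + 1 + i = (j + i) + 1 by ring, Nat.factorial_succ]
    have h3 : ((j + i).factorial : ℝ) ≠ 0 := by positivity
    have h4 : ((j : ℝ) + i + 1) ≠ 0 := by positivity
    push_cast
    field_simp
    ring
  exact le_of_tendsto_of_tendsto' ((h2 a).mul (h1 b)) ((h2 b).mul (h1 a))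
    fun N => sum_mul_sum_le_of_le w hwn ha.le hab _

/-! ### The threshold -/

/-- The difference of the two sides has the sign of the derivative of `1 / h_k`. That derivative
vanishes at the maximizer `muConst`, hence `muConst` cannot exceed the turning point `a` beyond
which it is negative, and it is positive before `a`. -/
theorem lt_of_lt_muConst (j : ℕ) {x : ℝ} (hx : 0 < x) (hxμ : x < muConst (j + 3)) :
    expTail (j + 2) x < x ^ (j + 2) / ((j + 1).factorial : ℝ) := by
  obtain ⟨a, ha, hlo, hhi⟩ := exists_turning j
  obtain ⟨hμ, hμc⟩ := muConst_spec (j + 3) (by omega)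
  set μ := muConst (j + 3) with hμdef
  set r : ℝ → ℝ := fun x => Real.exp (-x) * expTail (j + 2) x / x with hr
  have hd : HasDerivAt r ((Real.exp (-μ) * (μ ^ (j + 2) / ((j + 1).factorial : ℝ))
        - Real.exp (-μ) * expTail (j + 2) μ) / μ ^ 2) μ := by
    refine ((hasDerivAt_scaled j μ).div (hasDerivAt_id μ) hμ.ne').congr_deriv ?_
    have := hμ.ne'
    simp only [id_eq, mul_one]
    field_simp
    ring
  have hrh : ∀ x, 0 < x → r x = (hFun (j + 3) x)⁻¹ := by
    intro x hx
    have h1 := (expTail_pos (j + 2) x hx).ne'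
    have h2 : j + 3 - 1 = j + 2 := rfl
    simp only [hFun, hr, Real.exp_neg, h2]
    field_simp
  have hpos : ∀ x, 0 < x → 0 < hFun (j + 3) x := fun x hx =>
    div_pos (mul_pos (Real.exp_pos _) hx) (expTail_pos _ x hx)
  have hmax : IsLocalMax r μ := by
    filter_upwards [lt_mem_nhds hμ] with y hy
    rw [hrh y hy, hrh μ hμ]
    refine inv_anti₀ (hpos μ hμ) ?_
    rw [hμc]
    refine csInf_le ⟨0, ?_⟩ ⟨y, hy, rfl⟩
    rintro _ ⟨z, hz, rfl⟩
    exact (hpos z hz).le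
  have h0 := hmax.hasDerivAt_eq_zero hd
  rw [div_eq_zero_iff, or_iff_left (pow_pos hμ 2).ne'] at h0
  have hμa : μ ≤ a := by
    by_contra h
    push Not at h
    exact absurd h0 (hhi μ h).ne
  have h1 := hlo x hx (hxμ.trans_le hμa)
  rw [← mul_sub] at h1
  exact sub_pos.1 (pos_of_mul_pos_right h1 (Real.exp_pos _).le)

/-- The supercriticality condition in disguise: adding `k * truncMass k x` to both sides bounds the
mean `truncMean k x` by `k * (k - 1) * truncMass k x`. -/
theorem lt_truncMass_of_lt_muConst {k : ℕ} (hk : 3 ≤ k) {x : ℝ} (hx : 0 < x)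
    (hxμ : x < muConst k) : x < k * (k - 2) * truncMass k x := by
  obtain ⟨j, rfl⟩ : ∃ j, k = j + 3 := ⟨k - 3, by omega⟩
  have h := lt_of_lt_muConst j hx hxμ
  have hf := expTail_pos (j + 3) x hx
  rw [expTail_eq_add] at h
  have hj : (0 : ℝ) < ((j + 1).factorial : ℝ) := by positivity
  have e1 : (((j + 2).factorial : ℕ) : ℝ) = (j + 2) * ((j + 1).factorial : ℝ) := by
    rw [Nat.factorial_succ (j + 1)]; push_cast; ring
  have e2 : (((j + 3).factorial : ℕ) : ℝ) = (j + 3) * ((j + 2) * ((j + 1).factorial : ℝ)) := by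
    rw [Nat.factorial_succ (j + 2), Nat.cast_mul, e1]; push_cast; ring
  rw [e1] at h
  have h' : expTail (j + 3) x < (j + 1) * x ^ (j + 2) / ((j + 2) * ((j + 1).factorial : ℝ)) := by
    have : (j + 1) * x ^ (j + 2) / ((j + 2) * ((j + 1).factorial : ℝ))
        = x ^ (j + 2) / ((j + 1).factorial : ℝ)
          - x ^ (j + 2) / ((j + 2) * ((j + 1).factorial : ℝ)) := by
      field_simp
      ring
    rw [this]
    linarith
  have e3 : ((j + 3 : ℕ) : ℝ) * ((j + 3 : ℕ) - 2) * truncMass (j + 3) x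
      = x * ((j + 1) * x ^ (j + 2) / ((j + 2) * ((j + 1).factorial : ℝ))) / expTail (j + 3) x := by
    rw [truncMass, e2]
    push_cast
    field_simp
    ring
  rw [e3, lt_div_iff₀ hf]
  exact mul_lt_mul_of_pos_left h' hx

theorem continuousOn_truncMass (k : ℕ) : ContinuousOn (truncMass k) (Set.Ioi 0) := by
  have hc : Continuous (expTail k) := by unfold expTail; fun_prop
  exact ContinuousOn.div (by fun_prop) hc.continuousOn fun x hx => (expTail_pos k x hx).ne'

/-- Below the threshold `c_k'`, nearly truncated Poisson degrees are supercritical. -/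
theorem exists_supercritical {k : ℕ} (hk : 3 ≤ k) {ε : ℝ} (hε : 0 < ε) :
    ∃ η > 0, ∃ τ > 0, ∀ x y c : ℝ, ε ≤ x → c = x + k * y → c ≤ cPrime k - ε →
      truncMass k x * (1 - τ) ≤ y → (1 + η) * c ≤ k * (k - 1) * y := by
  set μ := muConst k with hμ
  have hk3 : (3 : ℝ) ≤ k := by exact_mod_cast hk
  have hμ0 : 0 < μ := (muConst_spec k hk).1
  have hcP : cPrime k = truncMean k μ := rfl
  -- On this compact set of admissible parameters the strict inequality becomes a uniform margin
  -- `η₀`. The endpoint `μ` is excluded by the mean condition.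
  set K : Set ℝ := Set.Icc ε μ ∩ {x | x + k * truncMass k x ≤ cPrime k - ε / 2} with hK
  have hcont : ContinuousOn (truncMass k) (Set.Icc ε μ) :=
    (continuousOn_truncMass k).mono fun x hx => hε.trans_le hx.1
  have hKc : IsCompact K := by
    have h1 : IsClosed K := by
      have := ContinuousOn.preimage_isClosed_of_isClosed
        (f := fun x => x + k * truncMass k x) (s := Set.Icc ε μ) (by fun_prop) isClosed_Icc
        (isClosed_Iic (a := cPrime k - ε / 2))
      exact this
    exact isCompact_Icc.of_isClosed_subset h1 Set.inter_subset_left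
  have hKpos : ∀ x ∈ K, 0 < k * (k - 2) * truncMass k x - x := by
    rintro x ⟨⟨h1, h2⟩, h3⟩
    refine sub_pos.2 (lt_truncMass_of_lt_muConst hk (hε.trans_le h1) (lt_of_le_of_ne h2 ?_))
    intro h
    have h3' : x + k * truncMass k x ≤ cPrime k - ε / 2 := h3
    rw [← truncMean_eq (by omega) (hε.trans_le h1), h, hcP] at h3'
    linarith
  obtain ⟨η₀, hη₀, hmin⟩ : ∃ η₀ > 0, ∀ x ∈ K, η₀ ≤ k * (k - 2) * truncMass k x - x := by
    rcases K.eq_empty_or_nonempty with h | h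
    · exact ⟨1, one_pos, by simp [h]⟩
    · have hc' : ContinuousOn (fun x => k * (k - 2) * truncMass k x - x) K := by
        have := hcont.mono (Set.inter_subset_left : K ⊆ _)
        fun_prop
      obtain ⟨x₀, hx₀, hx₀'⟩ := hKc.exists_isMinOn h hc'
      exact ⟨_, hKpos x₀ hx₀, fun x hx => hx₀' hx⟩
  have hkk : (0 : ℝ) < k * (k - 2) := mul_pos (by linarith) (by linarith)
  -- Half of the margin `η₀` pays for the factor `1 + η`, the other half for replacing the mass by
  -- `y`. The first bound on `τ` keeps the mean at `x` below `cPrime k - ε / 2`.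
  refine ⟨η₀ / (2 * (|cPrime k| + 1)), by positivity,
    min (ε / (2 * k)) (η₀ / (2 * (k * (k - 2)))), lt_min (by positivity) (by positivity), ?_⟩
  intro x y c hx hc hc' hy
  set τ := min (ε / (2 * k)) (η₀ / (2 * (k * (k - 2)))) with hτ
  have hτ0 : 0 < τ := lt_min (by positivity) (by positivity)
  have hx0 : 0 < x := hε.trans_le hx
  have hτ1 : k * τ ≤ ε / 2 := by
    have : τ ≤ ε / (2 * k) := min_le_left _ _
    calc k * τ ≤ k * (ε / (2 * k)) := by gcongr
      _ = ε / 2 := by field_simp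
  have hτ2 : k * (k - 2) * τ ≤ η₀ / 2 := by
    have : τ ≤ η₀ / (2 * (k * (k - 2))) := min_le_right _ _
    calc k * (k - 2) * τ ≤ k * (k - 2) * (η₀ / (2 * (k * (k - 2)))) :=
          mul_le_mul_of_nonneg_left this hkk.le
      _ = η₀ / 2 := by
        set q : ℝ := k * (k - 2)
        field_simp
  have hm0 := truncMass_nonneg k hx0
  have hm1 := truncMass_le_one k hx0
  have hy' : truncMass k x - τ ≤ y := by
    have : truncMass k x * τ ≤ τ := mul_le_of_le_one_left hτ0.le hm1
    linarith
  have hψ : x + k * truncMass k x ≤ cPrime k - ε / 2 := by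
    have : k * (truncMass k x - τ) ≤ k * y := by gcongr
    linarith
  -- A parameter above `μ` would have mean at least `cPrime k` by monotonicity.
  have hxK : x ∈ K := by
    refine ⟨⟨hx, ?_⟩, hψ⟩
    by_contra h
    push Not at h
    have h1 := truncMean_mono (k := k) (by omega) hμ0 h.le
    rw [truncMean_eq (by omega) hx0, ← hcP] at h1
    linarith
  have h1 := hmin x hxK
  have h2 : k * (k - 2) * (truncMass k x - τ) ≤ k * (k - 2) * y :=
    mul_le_mul_of_nonneg_left hy' hkk.le
  have h3 : η₀ / (2 * (|cPrime k| + 1)) * c ≤ η₀ / 2 := by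
    have h4 : c ≤ |cPrime k| + 1 := by linarith [le_abs_self (cPrime k)]
    calc η₀ / (2 * (|cPrime k| + 1)) * c ≤ η₀ / (2 * (|cPrime k| + 1)) * (|cPrime k| + 1) := by
          gcongr
      _ = η₀ / 2 := by field_simp
  have h5 : k * (k - 1) * y = k * (k - 2) * y + k * y := by ring
  rw [h5]
  linarith

/-- A sequence with approximately Poisson ratios has nearly the truncated Poisson mass at `k`. -/
theorem truncMass_le_of_recursion (k J : ℕ) {x : ℕ → ℝ} {l C ξ σ : ℝ} (hl : 0 < l) (hlC : l ≤ C)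
    (hξ : 0 ≤ ξ) (hx0 : 0 ≤ x k)
    (hrec : ∀ j < J, ((k + j + 1 : ℕ) : ℝ) * x (k + j + 1) ≤ l * x (k + j) + ξ)
    (hsum : 1 - σ ≤ ∑ j ∈ Finset.range J, x (k + j)) :
    truncMass k l * (1 - σ - ξ * (J * (C + 1) ^ J)) ≤ x k := by
  have hC : 0 < C := hl.trans_le hlC
  -- Iterating the recursion gives Poisson ratios with an accumulated error. The factor `C + 1`
  -- absorbs multiplication by `l ≤ C` and the new `ξ`; dividing by `k + j + 1 ≥ 1` only helps.
  have hbound : ∀ j ≤ J, x (k + j) ≤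
      x k * k.factorial * (l ^ j / ((k + j).factorial : ℝ)) + ξ * (C + 1) ^ j := by
    intro j
    induction j with
    | zero =>
      intro _
      have : (k.factorial : ℝ) ≠ 0 := by positivity
      simp only [add_zero, pow_zero, mul_one]
      have : x k * k.factorial * (1 / (k.factorial : ℝ)) = x k := by field_simp
      linarith
    | succ j ih =>
      intro hj
      have h1 := hrec j (by omega)
      have h2 := ih (by omega)
      set z : ℝ := ((k + j + 1 : ℕ) : ℝ) with hz
      have hz1 : 1 ≤ z := by rw [hz]; push_cast; linarith [(Nat.cast_nonneg k : (0 : ℝ) ≤ k),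
        (Nat.cast_nonneg j : (0 : ℝ) ≤ j)]
      have hz0 : 0 < z := by linarith
      have h3 : l * x (k + j) ≤ l * (x k * k.factorial * (l ^ j / ((k + j).factorial : ℝ)))
          + C * (ξ * (C + 1) ^ j) := by
        have h4 : l * (ξ * (C + 1) ^ j) ≤ C * (ξ * (C + 1) ^ j) :=
          mul_le_mul_of_nonneg_right hlC (by positivity)
        have h5 := mul_le_mul_of_nonneg_left h2 hl.le
        linarith
      have h6 : ξ ≤ ξ * (C + 1) ^ j :=
        le_mul_of_one_le_right hξ (one_le_pow₀ (by linarith))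
      have h7 : z * x (k + j + 1) ≤ z * (x k * k.factorial * (l ^ (j + 1) /
          ((k + (j + 1)).factorial : ℝ)) + ξ * (C + 1) ^ (j + 1)) := by
        have h8 : z * (x k * k.factorial * (l ^ (j + 1) / ((k + (j + 1)).factorial : ℝ)))
            = l * (x k * k.factorial * (l ^ j / ((k + j).factorial : ℝ))) := by
          rw [← add_assoc, Nat.factorial_succ, Nat.cast_mul, ← hz]
          have : ((k + j).factorial : ℝ) ≠ 0 := by positivity
          field_simp
          ring
        have h9 : ξ * (C + 1) ^ (j + 1) ≤ z * (ξ * (C + 1) ^ (j + 1)) :=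
          le_mul_of_one_le_left (by positivity) hz1
        rw [mul_add, h8]
        have : ξ * (C + 1) ^ (j + 1) = C * (ξ * (C + 1) ^ j) + ξ * (C + 1) ^ j := by ring
        linarith
      exact le_of_mul_le_mul_left h7 hz0
  have h1 : ∑ j ∈ Finset.range J, x (k + j) ≤
      ∑ j ∈ Finset.range J, (x k * k.factorial * (l ^ j / ((k + j).factorial : ℝ))
        + ξ * (C + 1) ^ J) := by
    refine Finset.sum_le_sum fun j hj => ?_
    have hj' := Finset.mem_range.1 hj
    refine (hbound j hj'.le).trans (add_le_add le_rfl (mul_le_mul_of_nonneg_left ?_ hξ))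
    exact pow_le_pow_right₀ (by linarith) hj'.le
  rw [Finset.sum_add_distrib, ← Finset.mul_sum, Finset.sum_const, Finset.card_range,
    nsmul_eq_mul] at h1
  have hlk : 0 < l ^ k := pow_pos hl k
  have hf := expTail_pos k l hl
  have h2 : ∑ j ∈ Finset.range J, l ^ j / ((k + j).factorial : ℝ) ≤ expTail k l / l ^ k := by
    rw [le_div_iff₀ hlk, Finset.sum_mul]
    refine le_trans (le_of_eq (Finset.sum_congr rfl fun j _ => ?_)) (sum_range_le_expTail k J hl.le)
    rw [pow_add]; ring
  have h3 : x k * k.factorial * ∑ j ∈ Finset.range J, l ^ j / ((k + j).factorial : ℝ)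
      ≤ x k * k.factorial * (expTail k l / l ^ k) :=
    mul_le_mul_of_nonneg_left h2 (by positivity)
  have h4 : 1 - σ - ξ * (J * (C + 1) ^ J) ≤ x k * k.factorial * (expTail k l / l ^ k) := by
    linarith
  have h5 := mul_le_mul_of_nonneg_left h4 (truncMass_nonneg k hl)
  refine h5.trans (le_of_eq ?_)
  have : (k.factorial : ℝ) ≠ 0 := by positivity
  rw [truncMass]
  field_simp

/-! ### Existence of cores -/

section existence

open Classical

/-- The disjoint union of cliques on `k + 1` consecutive vertices, the last clique also containing
the vertices left over. -/
def cliqueUnion (k n : ℕ) : SimpleGraph (Fin n) where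
  Adj u v := u ≠ v ∧ min (u.val / (k + 1)) (n / (k + 1) - 1) = min (v.val / (k + 1)) (n / (k + 1) - 1)
  symm := ⟨fun _ _ h => ⟨h.1.symm, h.2.symm⟩⟩
  loopless := ⟨fun _ h => h.1 rfl⟩

theorem le_degree_cliqueUnion {k n : ℕ} (hn : k + 1 ≤ n) (v : Fin n) :
    k ≤ (cliqueUnion k n).degree v := by
  have hq : 0 < n / (k + 1) := Nat.div_pos hn (Nat.succ_pos k)
  have hqn : n / (k + 1) * (k + 1) ≤ n := Nat.div_mul_le_self n (k + 1)
  set q := n / (k + 1) with hqdef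
  set b := min (v.val / (k + 1)) (q - 1) with hb
  have hbq : b + 1 ≤ q := by omega
  have hlt : ∀ i : Fin (k + 1), b * (k + 1) + i.val < n := by
    intro i
    have h1 := Nat.mul_le_mul_right (k + 1) hbq
    rw [Nat.add_mul, one_mul] at h1
    have := i.isLt
    omega
  have hinj : Function.Injective fun i : Fin (k + 1) => (⟨b * (k + 1) + i.val, hlt i⟩ : Fin n) := by
    intro i j h
    simp only [Fin.mk.injEq] at h
    exact Fin.ext (by omega)
  set s := (Finset.univ : Finset (Fin (k + 1))).image
    fun i : Fin (k + 1) => (⟨b * (k + 1) + i.val, hlt i⟩ : Fin n) with hs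
  have hcard : s.card = k + 1 := by
    rw [hs, Finset.card_image_of_injective _ hinj, Finset.card_univ, Fintype.card_fin]
  have hsub : s.erase v ⊆ (cliqueUnion k n).neighborFinset v := by
    intro w hw
    obtain ⟨hwv, hw⟩ := Finset.mem_erase.1 hw
    obtain ⟨i, -, rfl⟩ := Finset.mem_image.1 hw
    rw [SimpleGraph.mem_neighborFinset]
    refine ⟨hwv.symm, ?_⟩
    have h1 : (b * (k + 1) + i.val) / (k + 1) = b := by
      rw [mul_comm, Nat.mul_add_div (Nat.succ_pos k), Nat.div_eq_of_lt i.isLt, add_zero]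
    simp only [h1]
    rw [← hqdef, ← hb]
    omega
  have h1 := Finset.card_le_card hsub
  rw [SimpleGraph.card_neighborFinset_eq_degree] at h1
  have h2 := Finset.pred_card_le_card_erase (s := s) (a := v)
  omega

/-- Arcs inside a block of `k + 1` consecutive vertices number at most `k` per vertex. All other
arcs have both ends in the final stretch `R` of at most `2 * k + 2` vertices. -/
theorem sum_degree_cliqueUnion_le {k n : ℕ} (hn : k + 1 ≤ n) :
    ∑ v, (cliqueUnion k n).degree v ≤ k * n + (2 * k + 2) ^ 2 := by
  have hq : 0 < n / (k + 1) := Nat.div_pos hn (Nat.succ_pos k)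
  have hqn : n < (n / (k + 1) + 1) * (k + 1) := by
    have := Nat.lt_mul_div_succ n (Nat.succ_pos k)
    rwa [mul_comm] at this
  set q := n / (k + 1) with hqdef
  have hsplit : (q + 1) * (k + 1) = (q - 1) * (k + 1) + 2 * (k + 1) := by
    rw [← Nat.add_mul]
    congr 1
    omega
  set R : Finset (Fin n) := Finset.univ.filter fun v => (q - 1) * (k + 1) ≤ v.val with hR
  have hRcard : R.card ≤ 2 * k + 2 := by
    have : R.card ≤ (Finset.Ico ((q - 1) * (k + 1)) n).card := by
      refine Finset.card_le_card_of_injOn Fin.val ?_ Fin.val_injective.injOn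
      intro v hv
      rw [Finset.mem_coe] at hv
      rw [Finset.mem_coe, Finset.mem_Ico]
      exact ⟨(Finset.mem_filter.1 hv).2, v.isLt⟩
    rw [Nat.card_Ico] at this
    omega
  have hsub : arcs (cliqueUnion k n) ⊆
      ((Finset.univ ×ˢ Finset.univ).filter
        fun t : Fin n × Fin n => t.1 ≠ t.2 ∧ t.1.val / (k + 1) = t.2.val / (k + 1)) ∪ R ×ˢ R := by
    rintro ⟨u, v⟩ h
    obtain ⟨h1, h2⟩ := mem_arcs.1 h
    simp only [← hqdef] at h1 h2
    simp only [Finset.mem_union, Finset.mem_filter, Finset.mem_product, hR, Finset.mem_univ,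
      true_and]
    by_cases h3 : u.val / (k + 1) = v.val / (k + 1)
    · exact Or.inl ⟨h1, h3⟩
    · have hu : q - 1 ≤ u.val / (k + 1) := by omega
      have hv : q - 1 ≤ v.val / (k + 1) := by omega
      exact Or.inr ⟨(Nat.le_div_iff_mul_le (Nat.succ_pos k)).1 hu,
        (Nat.le_div_iff_mul_le (Nat.succ_pos k)).1 hv⟩
  rw [← card_arcs]
  refine (Finset.card_le_card hsub).trans ((Finset.card_union_le _ _).trans (add_le_add ?_ ?_))
  · rw [card_filter_prod]
    refine (Finset.sum_le_card_nsmul _ _ k fun u _ => ?_).trans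
      (by simp [mul_comm])
    have : (Finset.univ.filter fun v : Fin n => u ≠ v ∧ u.val / (k + 1) = v.val / (k + 1)).card ≤
        ((Finset.Ico (u.val / (k + 1) * (k + 1)) (u.val / (k + 1) * (k + 1) + (k + 1))).erase
          u.val).card := by
      refine Finset.card_le_card_of_injOn Fin.val ?_ Fin.val_injective.injOn
      intro v hv
      rw [Finset.mem_coe, Finset.mem_filter] at hv
      rw [Finset.mem_coe, Finset.mem_erase, Finset.mem_Ico]
      obtain ⟨-, h1, h2⟩ := hv
      have h3 := Nat.div_mul_le_self v.val (k + 1)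
      have h4 := Nat.lt_div_mul_add (a := v.val) (Nat.succ_pos k)
      rw [h2]
      exact ⟨fun h => h1 (Fin.ext h.symm), h3, h4⟩
    refine this.trans ?_
    rw [Finset.card_erase_of_mem, Nat.card_Ico]
    · omega
    · rw [Finset.mem_Ico]
      exact ⟨Nat.div_mul_le_self _ _, Nat.lt_div_mul_add (Nat.succ_pos k)⟩
  · rw [Finset.card_product, sq]
    exact Nat.mul_le_mul hRcard hRcard

/-- Edges are added to the clique union until there are `m`. Nonemptiness matters because `probLost`
is 0, by division by zero, when there are no cores. -/
theorem simpleCores_nonempty {k n m : ℕ} (hn : k + 1 ≤ n)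
    (h1 : k * n + (2 * k + 2) ^ 2 ≤ 2 * m) (h2 : 2 * m ≤ n * (n - 1)) :
    (simpleCores k n m).Nonempty := by
  have hE : (cliqueUnion k n).edgeFinset.card ≤ m := by
    have := (cliqueUnion k n).sum_degrees_eq_twice_card_edges
    have := sum_degree_cliqueUnion_le hn
    omega
  have htop : m ≤ (⊤ : SimpleGraph (Fin n)).edgeFinset.card := by
    rw [SimpleGraph.card_edgeFinset_top_eq_card_choose_two, Fintype.card_fin, Nat.choose_two_right]
    omega
  obtain ⟨E, hE1, hE2, hE3⟩ := Finset.exists_subsuperset_card_eq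
    (SimpleGraph.edgeFinset_mono (le_top : cliqueUnion k n ≤ ⊤)) hE htop
  obtain ⟨G, hG⟩ : ∃ G : SimpleGraph (Fin n), G.edgeSet = E := by
    refine ⟨SimpleGraph.fromEdgeSet E, ?_⟩
    rw [SimpleGraph.edgeSet_fromEdgeSet, sdiff_eq_left, Set.disjoint_left]
    intro e he
    have := hE2 he
    rw [SimpleGraph.mem_edgeFinset] at this
    exact SimpleGraph.not_isDiag_of_mem_edgeSet _ this
  have hGE : G.edgeFinset = E := by
    ext e
    rw [SimpleGraph.mem_edgeFinset, hG, Finset.mem_coe]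
  refine ⟨G, mem_simpleCores.2 ⟨?_, fun v => ?_⟩⟩
  · rw [SimpleGraph.sum_degrees_eq_twice_card_edges, hGE, hE3]
  · refine (le_degree_cliqueUnion hn v).trans (SimpleGraph.degree_le_of_le ?_)
    rw [← SimpleGraph.edgeSet_subset_edgeSet, hG]
    intro e he
    exact hE1 (SimpleGraph.mem_edgeFinset.2 he)

end existence

/-! ### Asymptotics -/

theorem tendsto_clog_sq_div (a : ℝ) :
    Tendsto (fun n : ℕ => (a + 3 * (Nat.clog 2 n : ℝ)) ^ 2 / n) atTop (𝓝 0) := by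
  have hlog2 : 0 < Real.log 2 := Real.log_pos (by norm_num)
  have hO : (fun n : ℕ => a + 3 * (Nat.clog 2 n : ℝ)) =O[atTop]
      fun n : ℕ => Real.log (n : ℝ) := by
    have h1 : (fun _ : ℕ => a) =O[atTop] fun n : ℕ => Real.log (n : ℝ) := by
      have := (Real.isLittleO_const_log_atTop (c := a)).comp_tendsto
        (tendsto_natCast_atTop_atTop (R := ℝ))
      exact this.isBigO
    refine h1.add (Asymptotics.IsBigO.const_mul_left ?_ 3)
    refine Asymptotics.IsBigO.of_bound (2 / Real.log 2) ?_
    filter_upwards [eventually_ge_atTop 2] with n hn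
    have hn' : (2 : ℝ) ≤ n := by exact_mod_cast hn
    have hl : Real.log 2 ≤ Real.log n := Real.log_le_log (by norm_num) hn'
    rw [Real.norm_of_nonneg (Nat.cast_nonneg _), Real.norm_of_nonneg (hlog2.le.trans hl)]
    have h2 : 2 ^ (Nat.clog 2 n - 1) < n := Nat.pow_pred_clog_lt_self (by norm_num) (by omega)
    have h3 : ((Nat.clog 2 n - 1 : ℕ) : ℝ) * Real.log 2 ≤ Real.log n := by
      rw [← Real.log_pow]
      refine Real.log_le_log (by positivity) ?_
      exact_mod_cast h2.le
    have h4 : 1 ≤ Nat.clog 2 n := Nat.clog_pos (by norm_num) hn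
    rw [Nat.cast_sub h4, Nat.cast_one] at h3
    rw [div_mul_eq_mul_div, le_div_iff₀ hlog2]
    linarith
  have h2 := (hO.pow 2).trans_isLittleO
    ((Real.isLittleO_pow_log_id_atTop (n := 2)).comp_tendsto (tendsto_natCast_atTop_atTop (R := ℝ)))
  exact h2.tendsto_div_nhds_zero

/-- Diagonal choice: `f n` is the largest `H ≤ n` whose threshold has been passed by `n`. -/
theorem exists_tendsto_of_forall_eventually {P : ℕ → ℕ → Prop}
    (h : ∀ H, ∀ᶠ n in atTop, P n H) :
    ∃ f : ℕ → ℕ, Tendsto f atTop atTop ∧ ∀ᶠ n in atTop, P n (f n) := by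
  have h' : ∀ H, ∃ N, ∀ n ≥ N, P n H := fun H => eventually_atTop.1 (h H)
  choose N hN using h'
  classical
  refine ⟨fun n => Nat.findGreatest (fun H => N H ≤ n) n, ?_, ?_⟩
  · refine tendsto_atTop.2 fun H => ?_
    filter_upwards [eventually_ge_atTop H, eventually_ge_atTop (N H)] with n h1 h2
    exact Nat.le_findGreatest h1 h2
  · filter_upwards [eventually_ge_atTop (N 0)] with n h0
    refine hN _ n ?_
    exact Nat.findGreatest_spec (P := fun H => N H ≤ n) (Nat.zero_le n) h0

/-! ### Typical cores are supercritical -/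

section typical

open Classical

variable {n : ℕ}

/-- Markov's inequality: at most `2 * m / (k + J)` vertices have degree at least `k + J`. -/
theorem le_sum_degNum {k m : ℕ} (J : ℕ) {G : SimpleGraph (Fin n)} (hG : G ∈ simpleCores k n m) :
    (k + J) * n ≤ (k + J) * ∑ j ∈ Finset.range J, degNum G (k + j) + 2 * m := by
  rw [mem_simpleCores] at hG
  set T := Finset.univ.filter fun v => ¬ G.degree v < k + J with hT
  have h1 : (Finset.univ.filter fun v => G.degree v < k + J).card
      ≤ ∑ j ∈ Finset.range J, degNum G (k + j) := by
    refine (Finset.card_le_card (t := (Finset.range J).biUnion fun j =>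
      Finset.univ.filter fun v => G.degree v = k + j) ?_).trans Finset.card_biUnion_le
    intro v hv
    have h2 := (Finset.mem_filter.1 hv).2
    have h3 := hG.2 v
    simp only [Finset.mem_biUnion, Finset.mem_range, Finset.mem_filter, Finset.mem_univ, true_and]
    exact ⟨G.degree v - k, by omega, by omega⟩
  have h2 : T.card * (k + J) ≤ 2 * m := by
    rw [← hG.1, ← smul_eq_mul]
    refine (Finset.card_nsmul_le_sum T (fun v => G.degree v) _ fun v hv => ?_).trans
      (Finset.sum_le_sum_of_subset (Finset.subset_univ _))
    exact not_lt.1 (Finset.mem_filter.1 hv).2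
  have h3 := Finset.card_filter_add_card_filter_not (s := (Finset.univ : Finset (Fin n)))
    (fun v => G.degree v < k + J)
  rw [Finset.card_univ, Fintype.card_fin] at h3
  have h4 : n ≤ ∑ j ∈ Finset.range J, degNum G (k + j) + T.card := by
    exact h3.symm.le.trans (Nat.add_le_add_right h1 _)
  calc (k + J) * n ≤ (k + J) * (∑ j ∈ Finset.range J, degNum G (k + j) + T.card) :=
        Nat.mul_le_mul_left _ h4
    _ = (k + J) * ∑ j ∈ Finset.range J, degNum G (k + j) + T.card * (k + J) := by ring
    _ ≤ _ := Nat.add_le_add_left h2 _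

/-- A core with small defects has a supercritical number of vertices of degree `k`. -/
theorem supercritical_of_defect {k m C J : ℕ} {ε η τ ξ : ℝ} (hk : 3 ≤ k) (hn : 0 < n)
    (hsup : ∀ x y c : ℝ, ε ≤ x → c = x + k * y → c ≤ cPrime k - ε →
      truncMass k x * (1 - τ) ≤ y → (1 + η) * c ≤ k * (k - 1) * y) (hε : 0 < ε) (hξ : 0 ≤ ξ)
    (hC : 2 * m ≤ C * n) (hc1 : (k : ℝ) + ε ≤ 2 * m / n) (hc2 : (2 * m / n : ℝ) ≤ cPrime k - ε)
    (hJ : (C : ℝ) / (k + J : ℕ) ≤ τ / 2) (hξJ : ξ * (J * (C + 1) ^ J) ≤ τ / 2)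
    {G : SimpleGraph (Fin n)} (hG : G ∈ simpleCores k n m)
    (hd : ∀ j < J, |defect k m (k + j) G| ≤ ξ * n ^ 2) :
    (1 + η) * (2 * m : ℝ) ≤ k * (k - 1) * (degNum G k : ℝ) := by
  have hn' : (0 : ℝ) < n := by exact_mod_cast hn
  have hC' : (2 * m : ℝ) ≤ C * n := by exact_mod_cast hC
  have hk0 : (0 : ℝ) ≤ k := Nat.cast_nonneg k
  set x : ℕ → ℝ := fun i => (degNum G i : ℝ) / n with hx
  have hx1 : x k ≤ 1 := by
    rw [hx]
    exact (div_le_one hn').2 (by exact_mod_cast degNum_le G k)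
  have hx0 : 0 ≤ x k := by rw [hx]; positivity
  -- The Poisson parameter read off from the defect equation; `x k ≤ 1` and the hypothesis on the
  -- average degree give `l ≥ ε`.
  set l : ℝ := 2 * m / n - k * x k with hl
  have hlε : ε ≤ l := by
    have : k * x k ≤ k := mul_le_of_le_one_right hk0 hx1
    linarith
  have hlC : l ≤ C := by
    have h1 : (2 * m / n : ℝ) ≤ C := (div_le_iff₀ hn').2 hC'
    have h2 : 0 ≤ k * x k := mul_nonneg hk0 hx0
    linarith
  have hrec : ∀ j < J, ((k + j + 1 : ℕ) : ℝ) * x (k + j + 1) ≤ l * x (k + j) + ξ := by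
    intro j hj
    have h1 := (le_abs_self _).trans (hd j hj)
    have h2 : ((k + j + 1 : ℕ) : ℝ) * x (k + j + 1) - l * x (k + j)
        = defect k m (k + j) G / n ^ 2 := by
      simp only [hl, hx, defect]
      field_simp
    have h3 : defect k m (k + j) G / n ^ 2 ≤ ξ := (div_le_iff₀ (by positivity)).2 h1
    linarith
  have hsum : 1 - (C : ℝ) / (k + J : ℕ) ≤ ∑ j ∈ Finset.range J, x (k + j) := by
    have h1 := le_sum_degNum J hG
    have h2 : ((k + J : ℕ) : ℝ) * n ≤ (k + J : ℕ) * ∑ j ∈ Finset.range J, (degNum G (k + j) : ℝ)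
        + 2 * m := by exact_mod_cast h1
    have hkJ : (0 : ℝ) < (k + J : ℕ) := by
      have : 0 < k + J := by omega
      exact_mod_cast this
    simp only [hx]
    rw [← Finset.sum_div, le_div_iff₀ hn', sub_mul, one_mul, sub_le_iff_le_add]
    refine le_of_mul_le_mul_left ?_ hkJ
    refine (h2.trans (add_le_add le_rfl hC')).trans (le_of_eq ?_)
    field_simp
  have hmass := truncMass_le_of_recursion k J (hε.trans_le hlε) hlC hξ hx0 hrec hsum
  have h1 : truncMass k l * (1 - τ) ≤ x k := by
    refine le_trans (mul_le_mul_of_nonneg_left ?_ (truncMass_nonneg k (hε.trans_le hlε))) hmass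
    linarith
  have h2 := hsup l (x k) (2 * m / n) hlε (by rw [hl]; ring) hc2 h1
  simp only [hx] at h2
  rw [← mul_div_assoc, ← mul_div_assoc] at h2
  exact (div_le_div_iff_of_pos_right hn').1 h2

/-- Most simple cores are good. -/
theorem card_simpleCores_le {k m C J D₀ : ℕ} {ε η τ ξ : ℝ} (hk : 3 ≤ k) (hn : 0 < n)
    (hsup : ∀ x y c : ℝ, ε ≤ x → c = x + k * y → c ≤ cPrime k - ε →
      truncMass k x * (1 - τ) ≤ y → (1 + η) * c ≤ k * (k - 1) * y) (hε : 0 < ε) (hξ : 0 < ξ)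
    (hC : 2 * m ≤ C * n) (hc1 : (k : ℝ) + ε ≤ 2 * m / n) (hc2 : (2 * m / n : ℝ) ≤ cPrime k - ε)
    (hJ : (C : ℝ) / (k + J : ℕ) ≤ τ / 2) (hξJ : ξ * (J * (C + 1) ^ J) ≤ τ / 2)
    (hm : 0 < m) (hkD : k ≤ D₀) (hD : 6 * m ≤ D₀ * n)
    (hsmall : (1 + J * (C * (2 * k + J + 1 + C) / ξ ^ 2)) * ((D₀ + 3 * Nat.clog 2 n + 4 : ℝ) / n)
      ≤ 1 / 2) :
    ((simpleCores k n m).card : ℝ) / 2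
      ≤ (goodCores k n m (D₀ + 3 * Nat.clog 2 n) η).card := by
  have hn' : (0 : ℝ) < n := by exact_mod_cast hn
  set S := simpleCores k n m with hS
  set B := D₀ + 3 * Nat.clog 2 n with hB
  set b : ℝ := D₀ + 3 * Nat.clog 2 n + 4 with hb
  have hb1 : 1 ≤ b := by
    have : (0 : ℝ) ≤ D₀ + 3 * Nat.clog 2 n := by positivity
    linarith
  -- A core that is not good has a large degree or one of `J` large defects; a union bound makes
  -- these a vanishing fraction.
  have hsub : S ⊆ goodCores k n m B η ∪ ((S.filter fun G => ¬ ∀ v, G.degree v ≤ B) ∪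
      (Finset.range J).biUnion fun j => S.filter fun G => ¬ |defect k m (k + j) G| ≤ ξ * n ^ 2) := by
    intro G hG
    by_cases h1 : ∀ v, G.degree v ≤ B
    · by_cases h2 : ∀ j < J, |defect k m (k + j) G| ≤ ξ * n ^ 2
      · refine Finset.mem_union_left _ (Finset.mem_filter.2 ⟨hG, h1, ?_⟩)
        exact supercritical_of_defect hk hn hsup hε hξ.le hC hc1 hc2 hJ hξJ hG h2
      · refine Finset.mem_union_right _ (Finset.mem_union_right _ ?_)
        push Not at h2
        obtain ⟨j, hj, h3⟩ := h2
        exact Finset.mem_biUnion.2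
          ⟨j, Finset.mem_range.2 hj, Finset.mem_filter.2 ⟨hG, not_le.2 h3⟩⟩
    · exact Finset.mem_union_right _ (Finset.mem_union_left _ (Finset.mem_filter.2 ⟨hG, h1⟩))
  have hcard := (Finset.card_le_card hsub).trans ((Finset.card_union_le _ _).trans
    (Nat.add_le_add_left ((Finset.card_union_le _ _).trans
      (Nat.add_le_add_left Finset.card_biUnion_le _)) _))
  have hcard' : (S.card : ℝ) ≤ (goodCores k n m B η).card +
      ((S.filter fun G => ¬ ∀ v, G.degree v ≤ B).card + ∑ j ∈ Finset.range J,
        ((S.filter fun G => ¬ |defect k m (k + j) G| ≤ ξ * n ^ 2).card : ℝ)) := by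
    exact_mod_cast hcard
  have h1 : ((S.filter fun G => ¬ ∀ v, G.degree v ≤ B).card : ℝ) ≤ S.card * (b / n) := by
    have h2 : (n : ℝ) * ((S.filter fun G => ¬ ∀ v, G.degree v ≤ B).card : ℝ) ≤ S.card := by
      exact_mod_cast card_large_degree_le hkD hm hD
    rw [← mul_div_assoc, le_div_iff₀ hn']
    have h3 : (S.card : ℝ) ≤ S.card * b := le_mul_of_one_le_right (Nat.cast_nonneg _) hb1
    linarith
  have h2 : ∀ j ∈ Finset.range J,
      ((S.filter fun G => ¬ |defect k m (k + j) G| ≤ ξ * n ^ 2).card : ℝ)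
        ≤ S.card * (C * (2 * k + J + 1 + C) / ξ ^ 2 * (b / n)) := by
    intro j hj
    have hj' : (j : ℝ) ≤ J := by exact_mod_cast (Finset.mem_range.1 hj).le
    have h3 := card_defect_gt_le (n := n) (i := k + j) (by omega) hkD hm hD hC hξ
    rw [← hb, ← hS] at h3
    have h4 : (S.card : ℝ) * (C * (2 * k + J + 1 + C) / ξ ^ 2 * (b / n))
        = C * (2 * k + J + 1 + C) * b * S.card / (ξ ^ 2 * n) := by field_simp
    rw [h4, le_div_iff₀ (by positivity)]
    refine h3.trans ?_
    have h5 : ((k + j : ℕ) : ℝ) + 1 + C + k ≤ 2 * k + J + 1 + C := by push_cast; linarith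
    gcongr
  have h3 := Finset.sum_le_sum h2
  rw [Finset.sum_const, Finset.card_range, nsmul_eq_mul] at h3
  have h4 : (S.card : ℝ) * ((1 + J * (C * (2 * k + J + 1 + C) / ξ ^ 2)) * (b / n))
      ≤ S.card * (1 / 2) := mul_le_mul_of_nonneg_left hsmall (Nat.cast_nonneg _)
  linarith

end typical

end CoreRobustness

end


/-! ### The main theorem -/

theorem mainTheorem8 (k : ℕ) (hk : 3 ≤ k) (ε : ℝ) (hε : 0 < ε) (m : ℕ → ℕ)
    (hm : ∀ᶠ n : ℕ in Filter.atTop,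
      (k : ℝ) + ε ≤ 2 * (m n : ℝ) / (n : ℝ) ∧
        2 * (m n : ℝ) / (n : ℝ) ≤ CoreRobustness.cPrime k - ε) :
    ∃ h : ℕ → ℕ, Filter.Tendsto h Filter.atTop Filter.atTop ∧
      ∃ δ : ℝ, 0 < δ ∧
        ∀ᶠ n : ℕ in Filter.atTop, δ ≤ CoreRobustness.probLost k n (m n) (h n) := by
  open CoreRobustness in
  obtain ⟨η, hη, τ, hτ, hsup⟩ := exists_supercritical hk hε
  obtain ⟨ρ, hρ0, hρ1, hroot⟩ := exists_survival_root hk hη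
  set C : ℕ := ⌈cPrime k⌉₊ with hC
  set D₀ : ℕ := 3 * C + k with hD₀
  obtain ⟨J, hJ⟩ : ∃ J : ℕ, (C : ℝ) / (k + J : ℕ) ≤ τ / 2 := by
    obtain ⟨J, hJ⟩ := exists_nat_gt ((C : ℝ) / (τ / 2))
    refine ⟨J, ?_⟩
    have hkJ : (0 : ℝ) < (k + J : ℕ) := by exact_mod_cast (by omega : 0 < k + J)
    rw [div_le_iff₀ hkJ]
    rw [div_lt_iff₀ (by positivity)] at hJ
    push_cast
    have : (0 : ℝ) ≤ τ / 2 * k := by positivity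
    linarith
  obtain ⟨ξ, hξ, hξJ⟩ : ∃ ξ : ℝ, 0 < ξ ∧ ξ * (J * (C + 1) ^ J) ≤ τ / 2 := by
    refine ⟨τ / 2 / (J * (C + 1) ^ J + 1), by positivity, ?_⟩
    rw [div_mul_eq_mul_div, div_le_iff₀ (by positivity)]
    have : (0 : ℝ) ≤ τ / 2 := by positivity
    linarith
  have hk3 : (3 : ℝ) ≤ k := by exact_mod_cast hk
  have hρk : ρ ^ k < 1 := pow_lt_one₀ hρ0 hρ1 (by omega)
  -- The lower bound does not depend on `H`, so the diagonal choice applies.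
  suffices hmain : ∀ H : ℕ, ∀ᶠ n : ℕ in atTop,
      (1 - ρ ^ k) / (4 * (k - 1)) ≤ probLost k n (m n) H by
    obtain ⟨h, h1, h2⟩ := exists_tendsto_of_forall_eventually hmain
    exact ⟨h, h1, _, div_pos (by linarith) (by linarith), h2⟩
  intro H
  set T : ℕ := (k - 1) * H with hT
  -- Twice `switchLoss T B` is `4 * T + 8 * B + 4 * B ^ 2`, and `8 * B + 4 * B ^ 2 ≤ 12 * b n ^ 2`
  -- because `B ≤ b n ≤ b n ^ 2`.
  set A : ℝ := k * (T + 1) + 4 * T + 12 with hA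
  set b : ℕ → ℝ := fun n => D₀ + 3 * Nat.clog 2 n + 4 with hb
  have hb1 : ∀ n, 1 ≤ b n := fun n => by
    have : (0 : ℝ) ≤ D₀ + 3 * Nat.clog 2 n := by positivity
    simp only [hb]
    linarith
  have hlim : Tendsto (fun n : ℕ => b n ^ 2 / n) atTop (𝓝 0) := by
    refine (tendsto_clog_sq_div (D₀ + 4)).congr fun n => ?_
    simp only [hb]
    ring
  have hlim1 := (hlim.const_mul (1 + J * (C * (2 * k + J + 1 + C) / ξ ^ 2))).eventually_le_const
    (by rw [mul_zero]; norm_num : _ < (1 / 2 : ℝ))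
  have hlim2 := (hlim.const_mul (T * A)).eventually_le_const
    (by rw [mul_zero]; linarith : _ < (1 - ρ ^ k) / 2)
  filter_upwards [hm, hlim1, hlim2, eventually_ge_atTop (k + 1), eventually_ge_atTop (C + 1),
    eventually_ge_atTop ⌈((2 * k + 2) ^ 2 : ℝ) / ε⌉₊] with n hn1 hl1 hl2 hnk hnC hnε
  have hn : 0 < n := by omega
  have hn' : (0 : ℝ) < n := by exact_mod_cast hn
  obtain ⟨hc1, hc2⟩ := hn1
  have hcm : (k + ε) * n ≤ 2 * m n := (le_div_iff₀ hn').1 hc1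
  have hmn : (n : ℝ) ≤ 2 * m n := by
    have : (1 : ℝ) * n ≤ (k + ε) * n := mul_le_mul_of_nonneg_right (by linarith) hn'.le
    linarith
  have hm0 : 0 < m n := by
    have : (0 : ℝ) < m n := by linarith
    exact_mod_cast this
  have hCn : 2 * m n ≤ C * n := by
    have h1 : (2 * m n / n : ℝ) ≤ C := by
      have := Nat.le_ceil (cPrime k)
      linarith
    have h2 := (div_le_iff₀ hn').1 h1
    exact_mod_cast h2
  have hDn : 6 * m n ≤ D₀ * n := by
    rw [hD₀, Nat.add_mul]
    have : 3 * (2 * m n) ≤ 3 * (C * n) := Nat.mul_le_mul_left 3 hCn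
    have h2 : 3 * (C * n) = 3 * C * n := by ring
    omega
  have hne : (simpleCores k n (m n)).Nonempty := by
    refine simpleCores_nonempty hnk ?_ ?_
    · have h1 : ((2 * k + 2) ^ 2 : ℝ) ≤ ε * n := by
        have := Nat.ceil_le.1 hnε
        rw [div_le_iff₀ hε] at this
        linarith
      have h2 : (k * n + (2 * k + 2) ^ 2 : ℝ) ≤ 2 * m n := by linarith
      exact_mod_cast h2
    · refine hCn.trans ?_
      rw [mul_comm]
      exact Nat.mul_le_mul_left n (by omega)
  have hbsq : b n ≤ b n ^ 2 := by
    have := hb1 n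
    nlinarith
  have hgood := card_simpleCores_le (n := n) hk hn hsup hε hξ hCn hc1 hc2 hJ hξJ hm0
    (by omega : k ≤ D₀) hDn (le_trans (mul_le_mul_of_nonneg_left
      (div_le_div_of_nonneg_right hbsq hn'.le) (by positivity)) hl1)
  -- Since `2 * m n ≥ n`, this `θ` covers the switching loss of each step, and `T` steps still cost
  -- only O(log² n / n).
  refine le_probLost (θ := A * (b n ^ 2 / n)) hk hη.le hρ0 hρ1.le hm0 hroot ?_ ?_ hne hgood
  · have hB : ((D₀ + 3 * Nat.clog 2 n : ℕ) : ℝ) ≤ b n := by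
      simp only [hb]
      push_cast
      linarith
    rw [← hT, switchLoss]
    set B := D₀ + 3 * Nat.clog 2 n
    have hB2 : (B : ℝ) * B ≤ b n ^ 2 := by
      rw [sq]
      exact mul_le_mul hB hB (Nat.cast_nonneg _) (by linarith [hb1 n])
    have h1 : (k * (T + 1) + 4 * T : ℝ) ≤ (k * (T + 1) + 4 * T) * b n ^ 2 :=
      le_mul_of_one_le_right (by positivity) ((hb1 n).trans hbsq)
    have h2 : A * b n ^ 2 ≤ A * (b n ^ 2 / n) * (2 * m n) := by
      have : A * b n ^ 2 = A * (b n ^ 2 / n) * n := by field_simp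
      rw [this]
      exact mul_le_mul_of_nonneg_left hmn (by positivity)
    refine le_trans ?_ h2
    rw [hA]
    push_cast
    linarith
  · refine le_trans (le_of_eq ?_) hl2
    rw [← hT]
    ring
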